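/- Let $n\ge 1$, let $P_Y=\mathcal N(0,I_n)$ be the standard Gaussian law on $\mathbb R^n$, and let $P_Z$ be a Borel probability measure on $\mathbb R^n$ with $P_Z\ll P_Y$ and $\mathbb E\|Z\|^2<\infty$ for $Z\sim P_Z$. For $0\le R<\infty$ define the information-constrained Wasserstein distance of order $2$ by $$W_2(P_Z,P_Y;R)=\inf_{P}\bigl\{\mathbb E_P[\|Z-Y\|^2]\bigr\}^{1/2},$$ where $\|\cdot\|$ is the Euclidean norm and the infimum runs over all couplings $P$ of $P_Z$ and $P_Y$ (joint laws of pairs $(Z,Y)$ with marginals $P_Z$ and $P_Y$) whose mutual information satisfies $I_P(Z;Y)=D(P\,\|\,P_Z\otimes P_Y)\le R$, measured in nats. Let $h(Z)=-\int f\ln f\in[-\infty,\infty)$ be the differential entropy of $Z$, where $f$ is the Lebesgue density of $P_Z$, with $e^{-\infty}=0$. Then $h(Z)<\infty$, $W_2(P_Z,P_Y;R)<\infty$, and $$W_2^2(P_Z,P_Y;R)\le \mathbb E\|Z\|^2+n-2n\sqrt{\frac{1}{2\pi e}\,e^{\frac{2}{n}h(Z)}\left(1-e^{-\frac{2R}{n}}\right)}.$$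 Moreover, the bound is tight for isotropic Gaussian laws: if $P_Z=\mathcal N(\mu,\sigma^2 I_n)$ for some $\mu\in\mathbb R^n$ and $\sigma>0$, then equality holds. -/

import Mathlib

open scoped ENNReal

namespace InfoOT

open MeasureTheory

/-- `P` is a coupling of `μ` and `ν`: its first marginal is `μ` and its second marginal is `ν`.
(If `μ` is a probability measure, then so is `P`.) -/
def IsCoupling {α β : Type*} [MeasurableSpace α] [MeasurableSpace β]
    (P : Measure (α × β)) (μ : Measure α) (ν : Measure β) : Prop :=
  P.fst = μ ∧ P.snd = ν

/-- The mutual information `I_P(Z;Y)` in nats of a pair `(Z, Y)` with joint law `P`: the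
Kullback-Leibler divergence of `P` from the product of its marginals. -/
noncomputable def mutualInfo {α β : Type*} [MeasurableSpace α] [MeasurableSpace β]
    (P : Measure (α × β)) : ℝ≥0∞ :=
  InformationTheory.klDiv P (P.fst.prod P.snd)

/-- The Wasserstein distance of order `p` between `μ` and `ν` subject to the information
constraint `R`: the infimum of `(E_P[d(Z,Y)^p])^(1/p)` over the couplings `P` of `μ` and `ν`
with `I_P(Z;Y) ≤ R`. -/
noncomputable def infoWasserstein {Ω : Type*} [MetricSpace Ω] [MeasurableSpace Ω]
    (p : ℝ) (μ ν : Measure Ω) (R : ℝ≥0∞) : ℝ≥0∞ :=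
  ⨅ P ∈ {P : Measure (Ω × Ω) | IsCoupling P μ ν ∧ mutualInfo P ≤ R},
    (∫⁻ ω, edist ω.1 ω.2 ^ p ∂P) ^ (1 / p)

open Classical in
/-- The differential entropy in nats `h(Z) = -∫ f log f` of a random variable with law `μ`, where
`f` is the density of `μ` with respect to Lebesgue measure, as an extended real number: the
integral of the positive part of `-f log f` minus the integral of its negative part. It is `-∞`
by convention when `μ` has no density. -/
noncomputable def differentialEntropy {E : Type*} [MeasureSpace E] (μ : Measure E) : EReal :=
  if μ ≪ (volume : Measure E) then
    ((∫⁻ x, ENNReal.ofReal (Real.negMulLog (μ.rnDeriv volume x).toReal) : ℝ≥0∞) : EReal) -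
      ((∫⁻ x, ENNReal.ofReal (-Real.negMulLog (μ.rnDeriv volume x).toReal) : ℝ≥0∞) : EReal)
  else ⊥

/-- The upper bound
`E‖Z‖² + n - 2 n √((1 / (2πe)) e^(2 h(Z) / n) (1 - e^(-2 R / n)))` for `Z` of law `PZ` on `ℝⁿ`.
The exponential of the extended real number `2 h(Z) / n` is `0` when `h(Z) = -∞`. -/
noncomputable def infoBound (n : ℕ) (PZ : Measure (EuclideanSpace ℝ (Fin n))) (R : ℝ) : ℝ :=
  (∫ z, ‖z‖ ^ 2 ∂PZ) + n -
    2 * n * √(1 / (2 * Real.pi * Real.exp 1) *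
      (EReal.exp (((2 / n : ℝ) : EReal) * differentialEntropy PZ)).toReal *
      (1 - Real.exp (-(2 * R / n))))

end InfoOT

namespace InfoOT

open MeasureTheory ProbabilityTheory Set Filter Topology
open InformationTheory (klFun klDiv)

/-! Expanding the square, the cost of a coupling is `E‖Z‖² + n - 2 E⟪Z, Y⟫`, so everything is about
the largest correlation `E⟪Z, Y⟫` available under the information constraint.

Upper bound. Talagrand's transport-entropy inequality, applied to the dilate `aZ` whose entropy
equals that of the standard Gaussian, produces a coupling with `E⟪Z, Y⟫ ≥ n e^(h/n) / √(2πe)` and no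
constraint on information (`exists_coupling_le_integral_inner`). Replacing `Y` by `ρY + √(1 - ρ²) N`
with independent Gaussian noise `N` keeps the marginals and multiplies the correlation by `ρ`. By
data processing, it also leaves information at most `-(n/2) log (1 - ρ²)`
(`IsCoupling.mutualInfo_noisyCoupling_le`). The choice `ρ = √(1 - e^(-2R/n))` makes this `R`. If `h
= -∞`, independence suffices.

Tightness. For two standard Gaussians, the Donsker-Varadhan inequality tested on the log-density of
the `ρ`-correlated pair gives `E⟪Z, Y⟫ ≤ nρ` (`IsCoupling.integral_inner_le_of_mutualInfo_le`). An
affine change of variable handles `N(μ, σ² I)`.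

Talagrand's inequality is proved in dimension one for the monotone map `T` from the Gaussian to `κ`,
without differentiating `T`. With `φ` the Gaussian density, `Φ` its distribution function, and `g =
φ ∘ Φ⁻¹ ∘ cdf κ`, Fubini gives `E[s T(s)] = ∫ g`, while `g(T(s)) = φ(s)`. For `F` the density of `κ`
relative to the Gaussian, integrating `F + F log (g/φ) - F log F ≤ g/φ` is exactly the claim. The
chain rule for divergence then raises the dimension one coordinate at a time
(`SatisfiesTalagrand.prod_stdGaussian`). -/

/-! ### Quantiles and monotone transport on the line. -/

/-- The quantile function of a law on `ℝ`. -/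
noncomputable def quantile (κ : Measure ℝ) (u : ℝ) : ℝ := sInf {t | u ≤ cdf κ t}

/-- Right continuity of the cdf makes the infimum attained. The strict bounds on `u` keep the set
nonempty and bounded below, so that `sInf` takes no default value. -/
lemma quantile_le_iff (κ : Measure ℝ) {u : ℝ} (hu0 : 0 < u) (hu1 : u < 1) (t : ℝ) :
    quantile κ u ≤ t ↔ u ≤ cdf κ t := by
  have hbdd : BddBelow {t | u ≤ cdf κ t} := by
    obtain ⟨b, hb⟩ := ((tendsto_cdf_atBot κ).eventually (gt_mem_nhds hu0)).exists
    refine ⟨b, fun a ha => ?_⟩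
    by_contra! h
    exact absurd (monotone_cdf κ h.le) (not_le.2 (hb.trans_le ha))
  have hne : {t | u ≤ cdf κ t}.Nonempty := by
    obtain ⟨b, hb⟩ := ((tendsto_cdf_atTop κ).eventually (lt_mem_nhds hu1)).exists
    exact ⟨b, hb.le⟩
  refine ⟨fun h => ?_, fun h => csInf_le hbdd h⟩
  have hlim : Tendsto (cdf κ) (𝓝[>] t) (𝓝 (cdf κ t)) :=
    ((cdf κ).right_continuous t).mono_left (nhdsWithin_mono _ Ioi_subset_Ici_self)
  refine ge_of_tendsto hlim (eventually_nhdsWithin_of_forall fun t' ht' => ?_)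
  obtain ⟨a, ha, hat⟩ := exists_lt_of_csInf_lt hne (lt_of_le_of_lt h ht')
  exact le_trans ha (monotone_cdf κ hat.le)

lemma continuous_cdf (κ : Measure ℝ) [IsProbabilityMeasure κ] [NullSingletonClass κ] :
    Continuous (cdf κ) := by
  refine continuous_iff_continuousAt.2 fun t => ?_
  rw [(monotone_cdf κ).continuousAt_iff_leftLim_eq_rightLim, (cdf κ).rightLim_eq]
  have h : (cdf κ).measure {t} = 0 := by rw [measure_cdf]; exact measure_singleton t
  rw [StieltjesFunction.measure_singleton, ENNReal.ofReal_eq_zero] at h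
  exact le_antisymm ((monotone_cdf κ).leftLim_le le_rfl) (by linarith)

lemma cdf_quantile (κ : Measure ℝ) [IsProbabilityMeasure κ] [NullSingletonClass κ]
    {u : ℝ} (hu0 : 0 < u) (hu1 : u < 1) : cdf κ (quantile κ u) = u := by
  refine le_antisymm ?_ ((quantile_le_iff κ hu0 hu1 _).1 le_rfl)
  have hlim : Tendsto (cdf κ) (𝓝[<] quantile κ u) (𝓝 (cdf κ (quantile κ u))) :=
    (continuous_cdf κ).continuousAt.mono_left nhdsWithin_le_nhds
  refine le_of_tendsto hlim (eventually_nhdsWithin_of_forall fun t ht => ?_)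
  by_contra! h
  exact absurd ((quantile_le_iff κ hu0 hu1 t).2 h.le) (not_le.2 ht)

/-- The standard Gaussian law on `ℝ`. -/
noncomputable abbrev stdGaussianReal : Measure ℝ := gaussianReal 0 1

instance : NullSingletonClass stdGaussianReal := nullSingletonClass_gaussianReal one_ne_zero

lemma strictMono_cdf_stdGaussianReal : StrictMono (cdf stdGaussianReal) := by
  intro a b hab
  have hpos : 0 < stdGaussianReal (Ioc a b) := by
    rw [pos_iff_ne_zero]
    intro h
    have := gaussianReal_absolutelyContinuous' 0 one_ne_zero h
    simp only [Real.volume_Ioc, ENNReal.ofReal_eq_zero] at this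
    linarith
  rw [← measure_cdf stdGaussianReal, StieltjesFunction.measure_Ioc] at hpos
  linarith [ENNReal.ofReal_pos.1 hpos]

lemma cdf_stdGaussianReal_pos (s : ℝ) : 0 < cdf stdGaussianReal s :=
  (cdf_nonneg _ (s - 1)).trans_lt (strictMono_cdf_stdGaussianReal (by linarith))

lemma cdf_stdGaussianReal_lt_one (s : ℝ) : cdf stdGaussianReal s < 1 :=
  (strictMono_cdf_stdGaussianReal (show s < s + 1 by linarith)).trans_le (cdf_le_one _ _)

lemma stdGaussianReal_cdf_le {u : ℝ} (hu0 : 0 ≤ u) (hu1 : u ≤ 1) :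
    stdGaussianReal {s | cdf stdGaussianReal s ≤ u} = ENNReal.ofReal u := by
  rcases hu0.eq_or_lt with rfl | hu0
  · have : {s | cdf stdGaussianReal s ≤ 0} = ∅ := by
      ext s; simp [cdf_stdGaussianReal_pos s]
    simp [this]
  rcases hu1.eq_or_lt with rfl | hu1
  · have : {s | cdf stdGaussianReal s ≤ 1} = univ := by
      ext s; simp [(cdf_stdGaussianReal_lt_one s).le]
    simp [this]
  have hq := cdf_quantile stdGaussianReal hu0 hu1
  have : {s | cdf stdGaussianReal s ≤ u} = Iic (quantile stdGaussianReal u) := by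
    ext s
    simp only [mem_ofPred_eq, mem_Iic]
    conv_lhs => rw [← hq]
    exact strictMono_cdf_stdGaussianReal.le_iff_le
  rw [this, ← ofReal_cdf, hq]

/-- The monotone rearrangement of the standard Gaussian law into `κ`. -/
noncomputable def gaussianTransport (κ : Measure ℝ) (s : ℝ) : ℝ :=
  quantile κ (cdf stdGaussianReal s)

lemma gaussianTransport_le_iff (κ : Measure ℝ) (s t : ℝ) :
    gaussianTransport κ s ≤ t ↔ cdf stdGaussianReal s ≤ cdf κ t :=
  quantile_le_iff κ (cdf_stdGaussianReal_pos s) (cdf_stdGaussianReal_lt_one s) t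

/-- Joint measurability in the parameter is what allows a different transport to be used on each
fibre of a product. -/
lemma measurable_uncurry_gaussianTransport {A : Type*} [MeasurableSpace A] {κ : A → Measure ℝ}
    (hκ : ∀ t, Measurable fun x => cdf (κ x) t) :
    Measurable fun p : A × ℝ => gaussianTransport (κ p.1) p.2 := by
  refine measurable_of_Iic fun t => ?_
  have : (fun p : A × ℝ => gaussianTransport (κ p.1) p.2) ⁻¹' Iic t =
      {p | cdf stdGaussianReal p.2 ≤ cdf (κ p.1) t} := by
    ext p; simp [gaussianTransport_le_iff]
  rw [this]
  exact measurableSet_le ((monotone_cdf _).measurable.comp measurable_snd)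
    ((hκ t).comp measurable_fst)

lemma measurable_gaussianTransport (κ : Measure ℝ) : Measurable (gaussianTransport κ) :=
  (measurable_uncurry_gaussianTransport (A := Unit) (κ := fun _ => κ)
    (fun _ => measurable_const)).comp (measurable_const (a := ()) |>.prodMk measurable_id)

/-- The Gaussian cdf of a Gaussian variable is uniform on `(0, 1)`, and the quantile function
carries the uniform law to `κ`; atoms of `κ` do no harm. -/
lemma map_gaussianTransport (κ : Measure ℝ) [IsProbabilityMeasure κ] :
    stdGaussianReal.map (gaussianTransport κ) = κ := by
  have := Measure.isProbabilityMeasure_map (μ := stdGaussianReal)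
    (measurable_gaussianTransport κ).aemeasurable
  refine Measure.ext_of_Iic _ _ fun t => ?_
  rw [Measure.map_apply (measurable_gaussianTransport κ) measurableSet_Iic]
  have h : gaussianTransport κ ⁻¹' Iic t = {s | cdf stdGaussianReal s ≤ cdf κ t} := by
    ext s; simp [gaussianTransport_le_iff]
  rw [h, stdGaussianReal_cdf_le (cdf_nonneg _ _) (cdf_le_one _ _), ofReal_cdf]

lemma cdf_gaussianTransport (κ : Measure ℝ) [IsProbabilityMeasure κ] [NullSingletonClass κ]
    (s : ℝ) : cdf κ (gaussianTransport κ s) = cdf stdGaussianReal s :=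
  cdf_quantile κ (cdf_stdGaussianReal_pos s) (cdf_stdGaussianReal_lt_one s)

/-! ### The isoperimetric profile and the correlation of the monotone transport. -/

/-- The Gaussian isoperimetric profile. -/
noncomputable def gaussianProfile (u : ℝ) : ℝ :=
  ∫ s in {s | u < cdf stdGaussianReal s}, s ∂stdGaussianReal

lemma gaussianPDFReal_zero_one (s : ℝ) :
    gaussianPDFReal 0 1 s = (√(2 * Real.pi))⁻¹ * Real.exp (-s ^ 2 / 2) := by
  simp [gaussianPDFReal]

lemma integral_Ioi_stdGaussianReal (s : ℝ) :
    ∫ t in Ioi s, t ∂stdGaussianReal = gaussianPDFReal 0 1 s := by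
  have hint : IntegrableOn (fun t => t * gaussianPDFReal 0 1 t) (Ioi s) := by
    have h := (integrable_mul_exp_neg_mul_sq (b := 1 / 2) (by norm_num)).const_mul
      (√(2 * Real.pi))⁻¹
    refine (h.congr (ae_of_all _ fun t => ?_)).integrableOn
    simp only [gaussianPDFReal_zero_one]
    ring_nf
  have hd : ∀ t ∈ Ici s, HasDerivAt (fun t => -gaussianPDFReal 0 1 t)
      (t * gaussianPDFReal 0 1 t) t := by
    intro t _
    have h1 : HasDerivAt (fun t : ℝ => -t ^ 2 / 2) (-t) t := by
      have := ((hasDerivAt_pow 2 t).neg).div_const 2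
      convert! this using 1
      simp only [Nat.cast_ofNat]
      ring
    have h2 := (h1.exp.const_mul (√(2 * Real.pi))⁻¹).neg
    convert! h2 using 1
    · ext x; simp [gaussianPDFReal_zero_one]
    · rw [gaussianPDFReal_zero_one]; ring
  have hlim : Tendsto (fun t => -gaussianPDFReal 0 1 t) atTop (𝓝 0) := by
    have h1 : Tendsto (fun t : ℝ => -t ^ 2 / 2) atTop atBot := by
      have := (tendsto_pow_atTop (α := ℝ) (n := 2) two_ne_zero).atTop_div_const
        (show (0 : ℝ) < 2 by norm_num)
      refine (tendsto_neg_atTop_atBot.comp this).congr fun t => ?_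
      simp [neg_div]
    have h2 := ((Real.tendsto_exp_atBot.comp h1).const_mul (√(2 * Real.pi))⁻¹).neg
    simp only [mul_zero, neg_zero] at h2
    refine h2.congr fun t => ?_
    simp [gaussianPDFReal_zero_one]
  have := integral_Ioi_of_hasDerivAt_of_tendsto' hd hint hlim
  rw [stdGaussianReal, gaussianReal_of_var_ne_zero 0 one_ne_zero,
    restrict_withDensity measurableSet_Ioi,
    integral_withDensity_eq_integral_toReal_smul (measurable_gaussianPDF 0 1)
      (ae_of_all _ fun _ => gaussianPDF_lt_top)]
  simp only [toReal_gaussianPDF, smul_eq_mul]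
  simp_rw [mul_comm (gaussianPDFReal 0 1 _)]
  rw [this]; ring

/-- The profile is `φ ∘ Φ⁻¹`, because `-φ` is a primitive of `t φ(t)`. Defining it as a partial mean
instead suits Fubini and gives the value `0` at both endpoints. -/
lemma gaussianProfile_cdf (s : ℝ) :
    gaussianProfile (cdf stdGaussianReal s) = gaussianPDFReal 0 1 s := by
  rw [gaussianProfile, ← integral_Ioi_stdGaussianReal]
  congr 2
  ext t
  simp [strictMono_cdf_stdGaussianReal.lt_iff_lt]

lemma gaussianProfile_nonneg {u : ℝ} (hu0 : 0 ≤ u) (hu1 : u ≤ 1) : 0 ≤ gaussianProfile u := by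
  rcases hu0.eq_or_lt with rfl | hu0
  · have : {s | 0 < cdf stdGaussianReal s} = univ := by ext s; simp [cdf_stdGaussianReal_pos s]
    simp [gaussianProfile, this]
  rcases hu1.eq_or_lt with rfl | hu1
  · have : {s | 1 < cdf stdGaussianReal s} = ∅ := by
      ext s; simp [(cdf_stdGaussianReal_lt_one s).le]
    simp [gaussianProfile, this]
  rw [← cdf_quantile stdGaussianReal hu0 hu1, gaussianProfile_cdf]
  exact gaussianPDFReal_nonneg _ _ _

lemma measurableSet_lt_gaussianTransport (κ : Measure ℝ) :
    MeasurableSet {p : ℝ × ℝ | p.2 < gaussianTransport κ p.1} :=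
  measurableSet_lt measurable_snd ((measurable_gaussianTransport κ).comp measurable_fst)

lemma gaussianProfile_cdf_eq_integral (κ : Measure ℝ) (t : ℝ) :
    gaussianProfile (cdf κ t) =
      ∫ s, {p : ℝ × ℝ | p.2 < gaussianTransport κ p.1}.indicator (fun p => p.1) (s, t)
        ∂stdGaussianReal := by
  have h : {s | cdf κ t < cdf stdGaussianReal s} = {s | t < gaussianTransport κ s} := by
    ext s; simp [← not_le, gaussianTransport_le_iff]
  rw [gaussianProfile, h, ← integral_indicator
    (measurableSet_lt measurable_const (measurable_gaussianTransport κ))]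
  rfl

lemma measurable_gaussianProfile_cdf (κ : Measure ℝ) :
    Measurable fun t => gaussianProfile (cdf κ t) := by
  simp_rw [gaussianProfile_cdf_eq_integral]
  exact (StronglyMeasurable.integral_prod_left' (μ := stdGaussianReal)
    (measurable_fst.indicator (measurableSet_lt_gaussianTransport κ)).stronglyMeasurable).measurable

lemma indicator_Iio_sub_indicator_Iio (a t : ℝ) :
    (Iio a).indicator (1 : ℝ → ℝ) t - (Iio 0).indicator 1 t =
      (Ico 0 a).indicator 1 t - (Ico a 0).indicator 1 t := by
  simp only [indicator, mem_Iio, mem_Ico, Pi.one_apply]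
  split_ifs <;> grind

lemma abs_indicator_Iio_sub_indicator_Iio (a t : ℝ) :
    |(Iio a).indicator (1 : ℝ → ℝ) t - (Iio 0).indicator 1 t| =
      (Ico 0 a).indicator 1 t + (Ico a 0).indicator 1 t := by
  simp only [indicator, mem_Iio, mem_Ico, Pi.one_apply]
  split_ifs <;> grind

lemma integrable_indicator_Ico (a b : ℝ) :
    Integrable ((Ico a b).indicator (1 : ℝ → ℝ)) :=
  (integrable_indicator_iff measurableSet_Ico).2 (integrableOn_const (by simp))

lemma integral_indicator_Ico (a b : ℝ) :
    ∫ t, (Ico a b).indicator (1 : ℝ → ℝ) t = max (b - a) 0 := by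
  rw [integral_indicator_one measurableSet_Ico, Real.volume_real_Ico]

/-- The Gaussian correlation of the monotone transport as an integral of the isoperimetric
profile. -/
lemma integral_mul_gaussianTransport (κ : Measure ℝ)
    (hint : Integrable (fun s => s * gaussianTransport κ s) stdGaussianReal) :
    Integrable (fun t => gaussianProfile (cdf κ t)) ∧
      ∫ s, s * gaussianTransport κ s ∂stdGaussianReal = ∫ t, gaussianProfile (cdf κ t) := by
  -- Layer-cake kernel: integrating the difference of indicators over `t` returns `T(s)`, of either
  -- sign. Subtracting the indicator of `t < 0` is what makes it integrable.
  set k : ℝ × ℝ → ℝ := fun p =>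
    p.1 * ((Iio (gaussianTransport κ p.1)).indicator 1 p.2 - (Iio 0).indicator 1 p.2) with hk
  have hkm : Measurable k := by
    refine measurable_fst.mul (Measurable.sub ?_ ?_)
    · exact (measurable_const (a := (1 : ℝ))).indicator (measurableSet_lt_gaussianTransport κ)
    · exact (measurable_one.indicator measurableSet_Iio).comp measurable_snd
  have hin : ∀ a : ℝ, Integrable fun t : ℝ =>
      (Iio a).indicator (1 : ℝ → ℝ) t - (Iio 0).indicator 1 t := by
    intro a
    simp_rw [indicator_Iio_sub_indicator_Iio]
    exact (integrable_indicator_Ico _ _).sub (integrable_indicator_Ico _ _)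
  have hval : ∀ a : ℝ, ∫ t : ℝ, ((Iio a).indicator (1 : ℝ → ℝ) t - (Iio 0).indicator 1 t) = a := by
    intro a
    simp_rw [indicator_Iio_sub_indicator_Iio]
    rw [integral_sub (integrable_indicator_Ico _ _) (integrable_indicator_Ico _ _),
      integral_indicator_Ico, integral_indicator_Ico]
    rcases le_total 0 a with h | h
    · rw [max_eq_left (by linarith), max_eq_right (by linarith)]; ring
    · rw [max_eq_right (by linarith), max_eq_left (by linarith)]; ring
  have habs : ∀ a : ℝ,
      ∫ t : ℝ, |(Iio a).indicator (1 : ℝ → ℝ) t - (Iio 0).indicator 1 t| = |a| := by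
    intro a
    simp_rw [abs_indicator_Iio_sub_indicator_Iio]
    rw [integral_add (integrable_indicator_Ico _ _) (integrable_indicator_Ico _ _),
      integral_indicator_Ico, integral_indicator_Ico]
    rcases le_total 0 a with h | h
    · rw [max_eq_left (by linarith), max_eq_right (by linarith), abs_of_nonneg h]; ring
    · rw [max_eq_right (by linarith), max_eq_left (by linarith), abs_of_nonpos h]; ring
  have hki : Integrable k (stdGaussianReal.prod volume) := by
    refine (integrable_prod_iff hkm.aestronglyMeasurable).2
      ⟨ae_of_all _ fun s => (hin (gaussianTransport κ s)).const_mul s, ?_⟩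
    refine hint.norm.congr (ae_of_all _ fun s => ?_)
    simp only [hk, Real.norm_eq_abs, abs_mul]
    rw [integral_const_mul, habs]
  have hswap := integral_integral_swap (f := fun s t => k (s, t)) hki
  -- Centring removes the subtracted indicator once the integration runs over `s` first.
  have hmean : ∫ s, s ∂stdGaussianReal = 0 := integral_id_gaussianReal
  have hsint : Integrable (fun s : ℝ => s) stdGaussianReal := IsGaussian.integrable_id
  have hright : ∀ t, ∫ s, k (s, t) ∂stdGaussianReal = gaussianProfile (cdf κ t) := by
    intro t
    have h1 : ∀ s, k (s, t) =
        {p : ℝ × ℝ | p.2 < gaussianTransport κ p.1}.indicator (fun p => p.1) (s, t) -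
          s * (Iio 0).indicator 1 t := by
      intro s
      simp only [hk, indicator, mem_Iio, mem_ofPred_eq, Pi.one_apply]
      split_ifs <;> ring
    simp_rw [h1]
    rw [integral_sub, integral_mul_const, hmean, zero_mul, sub_zero,
      ← gaussianProfile_cdf_eq_integral]
    · exact hsint.indicator
        (measurableSet_lt measurable_const (measurable_gaussianTransport κ))
    · exact hsint.mul_const _
  refine ⟨?_, ?_⟩
  · have := hki.integral_prod_right
    exact this.congr (ae_of_all _ hright)
  · simp_rw [hright] at hswap
    rw [← hswap]
    refine integral_congr_ae (ae_of_all _ fun s => ?_)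
    simp only [hk]
    rw [integral_const_mul, hval]

/-! ### Talagrand's inequality in dimension one. -/

/-- Young's inequality for the pair of conjugate functions `klFun` and `exp - 1`. -/
lemma mul_le_klFun_add_exp_sub_one {x : ℝ} (hx : 0 ≤ x) (a : ℝ) :
    a * x ≤ klFun x + (Real.exp a - 1) := by
  rw [InformationTheory.klFun_apply]
  rcases hx.eq_or_lt with rfl | hx
  · simp [(Real.exp_pos a).le]
  have h := Real.add_one_le_exp (a - Real.log x)
  rw [Real.exp_sub, Real.exp_log hx, le_div_iff₀ hx] at h
  nlinarith

/-- This is `1 + y ≤ e^y` at `y = log (a / x)`, multiplied by `x`. It replaces the change of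
variables in the usual proof of Talagrand's inequality, and also controls the positive part of the
entropy integrand. -/
lemma mul_one_add_log_sub_log_le {x a : ℝ} (hx : 0 ≤ x) (ha : 0 ≤ a) (hxa : x ≠ 0 → 0 < a) :
    x + x * Real.log a - x * Real.log x ≤ a := by
  rcases hx.eq_or_lt with rfl | hx
  · simpa using ha
  have ha' := hxa hx.ne'
  have h := Real.add_one_le_exp (Real.log a - Real.log x)
  rw [Real.exp_sub, Real.exp_log hx, Real.exp_log ha', le_div_iff₀ hx] at h
  nlinarith

lemma integrable_sq_stdGaussianReal : Integrable (fun s : ℝ => s ^ 2) stdGaussianReal :=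
  (IsGaussian.memLp_two_id (μ := stdGaussianReal)).integrable_sq

lemma integral_sq_stdGaussianReal : ∫ s, s ^ 2 ∂stdGaussianReal = 1 := by
  have h := variance_eq_sub (IsGaussian.memLp_two_id (μ := stdGaussianReal))
  rw [variance_id_gaussianReal] at h
  simpa using h.symm

lemma integrable_exp_sq_div_four_stdGaussianReal :
    Integrable (fun s : ℝ => Real.exp (s ^ 2 / 4)) stdGaussianReal := by
  rw [stdGaussianReal, gaussianReal_of_var_ne_zero 0 one_ne_zero,
    integrable_withDensity_iff_integrable_smul' (measurable_gaussianPDF 0 1)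
      (ae_of_all _ fun _ => gaussianPDF_lt_top)]
  refine ((integrable_exp_neg_mul_sq (b := 1 / 4) (by norm_num)).const_mul
    (√(2 * Real.pi))⁻¹).congr (ae_of_all _ fun s => ?_)
  simp only [toReal_gaussianPDF, gaussianPDFReal_zero_one, smul_eq_mul]
  rw [mul_assoc, ← Real.exp_add]
  ring_nf

lemma log_gaussianPDFReal_zero_one (s : ℝ) :
    Real.log (gaussianPDFReal 0 1 s) = -Real.log (√(2 * Real.pi)) - s ^ 2 / 2 := by
  rw [gaussianPDFReal_zero_one, Real.log_mul (by positivity) (Real.exp_pos _).ne', Real.log_exp,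
    Real.log_inv]
  ring

/-- **Talagrand's inequality** for the standard Gaussian law on `ℝ`, attained by the monotone
transport. -/
lemma lintegral_sq_gaussianTransport_sub_le {r : ℝ → ℝ≥0∞} (hr : Measurable r)
    [IsProbabilityMeasure (stdGaussianReal.withDensity r)] :
    ∫⁻ s, ENNReal.ofReal ((gaussianTransport (stdGaussianReal.withDensity r) s - s) ^ 2)
        ∂stdGaussianReal ≤
      2 * ∫⁻ t, ENNReal.ofReal (klFun (r t).toReal) ∂stdGaussianReal := by
  by_cases hfin : ∫⁻ t, ENNReal.ofReal (klFun (r t).toReal) ∂stdGaussianReal = ∞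
  · simp [hfin]
  set κ := stdGaussianReal.withDensity r with hκ
  set T := gaussianTransport κ with hT
  set F : ℝ → ℝ := fun t => (r t).toReal with hF
  have hFm : Measurable F := hr.ennreal_toReal
  have hF0 : ∀ t, 0 ≤ F t := fun t => ENNReal.toReal_nonneg
  have hac : κ ≪ stdGaussianReal := withDensity_absolutelyContinuous _ _
  have : NullSingletonClass κ := ⟨fun x => hac (measure_singleton x)⟩
  have hTm : Measurable T := measurable_gaussianTransport κ
  have hmap : stdGaussianReal.map T = κ := map_gaussianTransport κ
  have hone : ∫⁻ t, r t ∂stdGaussianReal = 1 := by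
    rw [← setLIntegral_univ, ← withDensity_apply _ MeasurableSet.univ]; exact measure_univ
  have hrt : ∀ᵐ t ∂stdGaussianReal, r t < ∞ := ae_lt_top hr (by simp [hone])
  have hFi : Integrable F stdGaussianReal := integrable_toReal_of_lintegral_ne_top hr.aemeasurable
    (by simp [hone])
  have hF1 : ∫ t, F t ∂stdGaussianReal = 1 := by
    rw [hF, integral_toReal hr.aemeasurable hrt, hone]; simp
  have hκint : ∀ g : ℝ → ℝ, Integrable g κ ↔ Integrable (fun t => F t * g t) stdGaussianReal :=
    fun g => integrable_withDensity_iff_integrable_smul' hr hrt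
  have hκval : ∀ g : ℝ → ℝ, ∫ t, g t ∂κ = ∫ t, F t * g t ∂stdGaussianReal :=
    fun g => integral_withDensity_eq_integral_toReal_smul hr hrt g
  have hkl : Integrable (fun t => klFun (F t)) stdGaussianReal :=
    (lintegral_ofReal_ne_top_iff_integrable
      (InformationTheory.measurable_klFun.comp hFm).aestronglyMeasurable
      (ae_of_all _ fun t => InformationTheory.klFun_nonneg (hF0 t))).1 hfin
  have hflogf : Integrable (fun t => F t * Real.log (F t)) stdGaussianReal := by
    refine ((hkl.add hFi).sub (integrable_const 1)).congr (ae_of_all _ fun t => ?_)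
    simp only [Pi.sub_apply, Pi.add_apply, InformationTheory.klFun_apply]
    ring
  have hklval : ∫ t, klFun (F t) ∂stdGaussianReal =
      ∫ t, F t * Real.log (F t) ∂stdGaussianReal := by
    have h1 : ∀ t, klFun (F t) = F t * Real.log (F t) + (1 - F t) := fun t => by
      rw [InformationTheory.klFun_apply]; ring
    simp_rw [h1]
    have hsub : Integrable (fun t => 1 - F t) stdGaussianReal := (integrable_const 1).sub hFi
    rw [integral_add hflogf hsub, integral_sub (integrable_const 1) hFi, hF1]
    simp
  -- Finite divergence forces a finite second moment: Young's inequality against `t² / 4`, whose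
  -- exponential is Gaussian-integrable.
  have hsqF : Integrable (fun t => F t * t ^ 2) stdGaussianReal := by
    refine ((hkl.add (integrable_exp_sq_div_four_stdGaussianReal.sub
      (integrable_const 1))).const_mul 4).mono'
      (hFm.mul (by fun_prop)).aestronglyMeasurable (ae_of_all _ fun t => ?_)
    rw [Real.norm_of_nonneg (mul_nonneg (hF0 t) (sq_nonneg t))]
    have := mul_le_klFun_add_exp_sub_one (hF0 t) (t ^ 2 / 4)
    simp only [Pi.add_apply, Pi.sub_apply]
    linarith
  have hsqκ : Integrable (fun t : ℝ => t ^ 2) κ := (hκint _).2 hsqF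
  have hT2 : Integrable (fun s => T s ^ 2) stdGaussianReal := by
    rw [← hmap] at hsqκ
    exact hsqκ.comp_measurable hTm
  have hT2val : ∫ s, T s ^ 2 ∂stdGaussianReal = ∫ t, t ^ 2 ∂κ := by
    rw [← hmap, integral_map hTm.aemeasurable (by fun_prop)]
  have hsT : Integrable (fun s => s * T s) stdGaussianReal := by
    refine (hT2.add integrable_sq_stdGaussianReal).mono'
      (measurable_id.mul hTm).aestronglyMeasurable (ae_of_all _ fun s => ?_)
    simp only [Real.norm_eq_abs, Pi.add_apply]
    rw [abs_le]
    constructor <;> nlinarith [sq_nonneg (s + T s), sq_nonneg (s - T s)]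
  obtain ⟨hgi, hgval⟩ := integral_mul_gaussianTransport κ hsT
  set g : ℝ → ℝ := fun t => gaussianProfile (cdf κ t) with hg
  have hgm : Measurable g := measurable_gaussianProfile_cdf κ
  have hgT : ∀ s, g (T s) = gaussianPDFReal 0 1 s := fun s => by
    simp only [hg, hT]
    rw [cdf_gaussianTransport, gaussianProfile_cdf]
  set φ := gaussianPDFReal 0 1 with hφ
  have hφpos : ∀ t, 0 < φ t := fun t => gaussianPDFReal_pos _ _ _ one_ne_zero
  have hai : Integrable (fun t => g t / φ t) stdGaussianReal := by
    rw [stdGaussianReal, gaussianReal_of_var_ne_zero 0 one_ne_zero,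
      integrable_withDensity_iff_integrable_smul' (measurable_gaussianPDF 0 1)
        (ae_of_all _ fun _ => gaussianPDF_lt_top)]
    refine hgi.congr (ae_of_all _ fun t => ?_)
    simp only [toReal_gaussianPDF, smul_eq_mul]
    rw [mul_div_cancel₀ _ (hφpos t).ne']
  have haval : ∫ t, g t / φ t ∂stdGaussianReal = ∫ s, s * T s ∂stdGaussianReal := by
    rw [hgval, stdGaussianReal, integral_gaussianReal_eq_integral_smul one_ne_zero]
    refine integral_congr_ae (ae_of_all _ fun t => ?_)
    simp only [smul_eq_mul]
    rw [mul_div_cancel₀ _ (hφpos t).ne']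
  -- `g` may vanish outside the support of `κ`; positivity is known only `κ`-almost everywhere,
  -- where `g` takes values of `φ`.
  have hgpos : ∀ᵐ t ∂stdGaussianReal, F t ≠ 0 → 0 < g t := by
    have h1 : ∀ᵐ t ∂κ, 0 < g t := by
      rw [← hmap, ae_map_iff hTm.aemeasurable (measurableSet_lt measurable_const hgm)]
      exact ae_of_all _ fun s => by rw [hgT]; exact hφpos s
    rw [hκ, ae_withDensity_iff hr] at h1
    filter_upwards [h1] with t ht hFt
    exact ht fun h => hFt (by simp [hF, h])
  have hlogφ : Integrable (fun s => Real.log (φ s)) stdGaussianReal := by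
    simp_rw [hφ, log_gaussianPDFReal_zero_one]
    exact (integrable_const _).sub (integrable_sq_stdGaussianReal.div_const 2)
  have hlogφκ : Integrable (fun s => Real.log (φ s)) κ := by
    simp_rw [hφ, log_gaussianPDFReal_zero_one]
    exact (integrable_const _).sub (hsqκ.div_const 2)
  have hloggκ : Integrable (fun t => Real.log (g t)) κ := by
    rw [← hmap, integrable_map_measure hgm.log.aestronglyMeasurable hTm.aemeasurable]
    simpa only [Function.comp_def, hgT] using hlogφ
  have hloggval : ∫ t, Real.log (g t) ∂κ = ∫ s, Real.log (φ s) ∂stdGaussianReal := by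
    rw [← hmap, integral_map hTm.aemeasurable hgm.log.aestronglyMeasurable]
    simp only [hgT]
  have hv1 : ∫ s, Real.log (φ s) ∂stdGaussianReal = -Real.log (√(2 * Real.pi)) - 1 / 2 := by
    simp_rw [hφ, log_gaussianPDFReal_zero_one]
    rw [integral_sub (integrable_const _) (integrable_sq_stdGaussianReal.div_const 2),
      integral_div, integral_sq_stdGaussianReal]
    simp
  have hv2 : ∫ s, Real.log (φ s) ∂κ = -Real.log (√(2 * Real.pi)) - (∫ t, t ^ 2 ∂κ) / 2 := by
    simp_rw [hφ, log_gaussianPDFReal_zero_one]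
    rw [integral_sub (integrable_const _) (hsqκ.div_const 2), integral_div]
    simp
  have hlog1 := (hκint _).1 hloggκ
  have hlog2 := (hκint _).1 hlogφκ
  have hlog3 : Integrable (fun t => F t * Real.log (g t) - F t * Real.log (φ t))
      stdGaussianReal := hlog1.sub hlog2
  have hlog4 : Integrable (fun t => F t + (F t * Real.log (g t) - F t * Real.log (φ t)))
      stdGaussianReal := hFi.add hlog3
  -- The entropy bound with `x = F` and `a = g / φ`. On the left, `∫ log g ∂κ` pulls back along `T`
  -- to `∫ log φ` under the Gaussian; on the right stands the correlation of `s` and `T(s)`.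
  have hpt : ∫ t, (F t + (F t * Real.log (g t) - F t * Real.log (φ t)) - F t * Real.log (F t))
      ∂stdGaussianReal ≤ ∫ t, g t / φ t ∂stdGaussianReal := by
    refine integral_mono_ae (hlog4.sub hflogf) hai ?_
    filter_upwards [hgpos] with t ht
    have hg0 : 0 ≤ g t := gaussianProfile_nonneg (cdf_nonneg _ _) (cdf_le_one _ _)
    refine le_trans (le_of_eq ?_) (mul_one_add_log_sub_log_le (hF0 t)
      (div_nonneg hg0 (hφpos t).le) fun h => div_pos (ht h) (hφpos t))
    by_cases h : F t = 0
    · simp [h]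
    · rw [Real.log_div (ht h).ne' (hφpos t).ne']; ring
  rw [integral_sub hlog4 hflogf, integral_add hFi hlog3,
    integral_sub hlog1 hlog2, hF1, ← hκval, ← hκval, hloggval, hv1, hv2, haval] at hpt
  have hexp : ∀ s, (T s - s) ^ 2 = T s ^ 2 + s ^ 2 - 2 * (s * T s) := fun s => by ring
  have hadd : Integrable (fun s => T s ^ 2 + s ^ 2) stdGaussianReal :=
    hT2.add integrable_sq_stdGaussianReal
  have hint : Integrable (fun s => (T s - s) ^ 2) stdGaussianReal := by
    simp_rw [hexp]
    exact hadd.sub (hsT.const_mul 2)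
  rw [← ofReal_integral_eq_lintegral_ofReal hint (ae_of_all _ fun s => sq_nonneg _),
    ← ofReal_integral_eq_lintegral_ofReal hkl
      (ae_of_all _ fun t => InformationTheory.klFun_nonneg (hF0 t)),
    show (2 : ℝ≥0∞) = ENNReal.ofReal 2 by simp, ← ENNReal.ofReal_mul (by norm_num)]
  refine ENNReal.ofReal_le_ofReal ?_
  simp_rw [hexp]
  rw [integral_sub hadd (hsT.const_mul 2),
    integral_add hT2 integrable_sq_stdGaussianReal, integral_const_mul,
    integral_sq_stdGaussianReal, hT2val, hklval]
  linarith

lemma IsCoupling.isProbabilityMeasure {A B : Type*} [MeasurableSpace A] [MeasurableSpace B]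
    {P : Measure (A × B)} {μ : Measure A} {ν : Measure B} [IsProbabilityMeasure μ]
    (h : IsCoupling P μ ν) : IsProbabilityMeasure P := by
  rw [← Measure.isProbabilityMeasure_map_iff (f := Prod.fst) measurable_fst.aemeasurable]
  change IsProbabilityMeasure P.fst
  rw [h.1]; infer_instance

/-- The transport-entropy inequality for the law `μ` and the cost `c`: every law `ν` of finite
divergence from `μ` has a coupling with `μ` of cost at most twice that divergence. -/
def SatisfiesTalagrand {A : Type*} [MeasurableSpace A] (μ : Measure A) (c : A → A → ℝ≥0∞) : Prop :=
  ∀ ν : Measure A, IsProbabilityMeasure ν → klDiv ν μ ≠ ∞ →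
    ∃ π : Measure (A × A), IsCoupling π ν μ ∧ ∫⁻ p, c p.1 p.2 ∂π ≤ 2 * klDiv ν μ

/-! ### Tensorisation and the `n`-dimensional Talagrand inequality. -/

section Tensor

variable {A : Type*} [MeasurableSpace A]

/-- Normalise a conditional density so that every section is a probability density. -/
lemma exists_conditional_density (ν₁ : Measure A) [IsProbabilityMeasure ν₁]
    (γ : Measure ℝ) [IsProbabilityMeasure γ] (ν : Measure (A × ℝ)) [IsProbabilityMeasure ν]
    (hfst : ν.fst = ν₁) (hac : ν ≪ ν₁.prod γ) :
    ∃ r : A → ℝ → ℝ≥0∞, Measurable (Function.uncurry r) ∧ (∀ x, ∫⁻ t, r x t ∂γ = 1) ∧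
      ∀ᵐ x ∂ν₁, ∀ t, ν.rnDeriv (ν₁.prod γ) (x, t) = r x t := by
  set r₀ := ν.rnDeriv (ν₁.prod γ) with hr₀
  have hr₀m : Measurable r₀ := Measure.measurable_rnDeriv _ _
  have hm : Measurable fun x => ∫⁻ t, r₀ (x, t) ∂γ := hr₀m.lintegral_prod_right'
  have hS : MeasurableSet {x | ∫⁻ t, r₀ (x, t) ∂γ = 1} := measurableSet_eq_fun hm measurable_const
  have hae : ∀ᵐ x ∂ν₁, ∫⁻ t, r₀ (x, t) ∂γ = 1 := by
    refine ae_eq_of_forall_setLIntegral_eq_of_sigmaFinite hm measurable_const fun B hB _ => ?_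
    have h1 : ν (B ×ˢ univ) = ν₁ B := by
      rw [← hfst, Measure.fst_apply hB]
      congr 1
      ext; simp
    rw [← Measure.setLIntegral_rnDeriv hac, setLIntegral_prod _ hr₀m.aemeasurable] at h1
    simpa using h1
  classical
  -- On the exceptional null set the default density `1` makes the fibre law `γ` itself.
  refine ⟨fun x t => if ∫⁻ t, r₀ (x, t) ∂γ = 1 then r₀ (x, t) else 1, ?_, fun x => ?_, ?_⟩
  · exact Measurable.ite (measurable_fst hS) hr₀m measurable_const
  · by_cases h : ∫⁻ t, r₀ (x, t) ∂γ = 1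
    · simp [h]
    · simp [h]
  · filter_upwards [hae] with x hx t
    simp [hx]

lemma measurable_cdf_withDensity {γ : Measure ℝ} [IsProbabilityMeasure γ] {r : A → ℝ → ℝ≥0∞}
    (hr : Measurable (Function.uncurry r)) (hr1 : ∀ x, ∫⁻ t, r x t ∂γ = 1) (t : ℝ) :
    Measurable fun x => cdf (γ.withDensity (r x)) t := by
  have hp : ∀ x, IsProbabilityMeasure (γ.withDensity (r x)) := fun x =>
    ⟨by rw [withDensity_apply _ MeasurableSet.univ, setLIntegral_univ, hr1]⟩
  simp_rw [cdf_eq_real, measureReal_def, withDensity_apply _ measurableSet_Iic]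
  exact (Measurable.lintegral_prod_right' (f := Function.uncurry r) hr).ennreal_toReal

lemma klDiv_prod_eq_add (μ : Measure A) [IsProbabilityMeasure μ] (γ : Measure ℝ)
    [IsProbabilityMeasure γ] (ν : Measure (A × ℝ)) [IsProbabilityMeasure ν] :
    klDiv ν (μ.prod γ) = klDiv ν.fst μ + klDiv ν (ν.fst.prod γ) := by
  have h := InformationTheory.klDiv_compProd_eq_add ν.fst μ ν.condKernel (Kernel.const A γ)
  rwa [Measure.disintegrate, Measure.compProd_const, Measure.compProd_const] at h

/-- A law on `A × ℝ` with a density relative to `ν₁ ⊗ N(0, 1)` is obtained by transporting each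
fibre monotonically. -/
lemma map_prod_gaussianTransport {ν₁ : Measure A} [IsProbabilityMeasure ν₁]
    {ν : Measure (A × ℝ)} [IsProbabilityMeasure ν] (hac : ν ≪ ν₁.prod stdGaussianReal)
    {r : A → ℝ → ℝ≥0∞}
    (hp : ∀ x, IsProbabilityMeasure (stdGaussianReal.withDensity (r x)))
    (hr₀ : ∀ᵐ x ∂ν₁, ∀ t, ν.rnDeriv (ν₁.prod stdGaussianReal) (x, t) = r x t)
    (hgm : Measurable fun p : A × ℝ =>
      (p.1, gaussianTransport (stdGaussianReal.withDensity (r p.1)) p.2)) :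
    (ν₁.prod stdGaussianReal).map
      (fun p => (p.1, gaussianTransport (stdGaussianReal.withDensity (r p.1)) p.2)) = ν := by
  ext B hB
  rw [Measure.map_apply hgm hB, Measure.prod_apply (hgm hB),
    ← Measure.setLIntegral_rnDeriv hac, ← lintegral_indicator hB,
    lintegral_prod _ ((Measure.measurable_rnDeriv _ _).indicator hB).aemeasurable]
  refine lintegral_congr_ae ?_
  filter_upwards [hr₀] with x hx
  have hsec : MeasurableSet (Prod.mk x ⁻¹' B) := measurable_prodMk_left hB
  have h1 : Prod.mk x ⁻¹' ((fun p : A × ℝ =>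
      (p.1, gaussianTransport (stdGaussianReal.withDensity (r p.1)) p.2)) ⁻¹' B) =
      gaussianTransport (stdGaussianReal.withDensity (r x)) ⁻¹' (Prod.mk x ⁻¹' B) := rfl
  rw [h1, ← Measure.map_apply (measurable_gaussianTransport _) hsec, map_gaussianTransport,
    withDensity_apply _ hsec, ← lintegral_indicator hsec]
  refine lintegral_congr fun t => ?_
  by_cases ht : (x, t) ∈ B
  · rw [indicator_of_mem ht, indicator_of_mem (show t ∈ Prod.mk x ⁻¹' B from ht), hx]
  · rw [indicator_of_notMem ht, indicator_of_notMem (show t ∉ Prod.mk x ⁻¹' B from ht)]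

/-- Couple the `A`-marginals by hypothesis, then transport the Gaussian coordinate monotonically
onto the conditional law of `ν`. The two costs match the two terms of the chain rule for divergence.
-/
lemma SatisfiesTalagrand.prod_stdGaussianReal {μ : Measure A} [IsProbabilityMeasure μ]
    {c : A → A → ℝ≥0∞} (hc : Measurable (Function.uncurry c)) (h : SatisfiesTalagrand μ c) :
    SatisfiesTalagrand (μ.prod stdGaussianReal)
      (fun p q => c p.1 q.1 + ENNReal.ofReal ((p.2 - q.2) ^ 2)) := by
  intro ν hν hfin
  rw [klDiv_prod_eq_add] at hfin ⊢
  obtain ⟨hfin1, hfin2⟩ := ENNReal.add_ne_top.1 hfin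
  set ν₁ := ν.fst with hν₁
  obtain ⟨π₁, ⟨hπ₁f, hπ₁s⟩, hπ₁c⟩ := h ν₁ inferInstance hfin1
  have hπ₁p : IsProbabilityMeasure π₁ := IsCoupling.isProbabilityMeasure ⟨hπ₁f, hπ₁s⟩
  have hac := (InformationTheory.klDiv_ne_top_iff.1 hfin2).1
  obtain ⟨r, hr, hr1, hr₀⟩ := exists_conditional_density ν₁ stdGaussianReal ν rfl hac
  have hrx : ∀ x, Measurable (r x) := fun x => hr.of_uncurry_left
  have hp : ∀ x, IsProbabilityMeasure (stdGaussianReal.withDensity (r x)) := fun x =>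
    ⟨by rw [withDensity_apply _ MeasurableSet.univ, setLIntegral_univ, hr1]⟩
  set T : A × ℝ → ℝ := fun p => gaussianTransport (stdGaussianReal.withDensity (r p.1)) p.2 with hT
  have hTm : Measurable T :=
    measurable_uncurry_gaussianTransport (κ := fun x => stdGaussianReal.withDensity (r x))
      (measurable_cdf_withDensity hr hr1)
  have hgm : Measurable fun p : A × ℝ => (p.1, T p) := measurable_fst.prodMk hTm
  have hνmap : (ν₁.prod stdGaussianReal).map (fun p => (p.1, T p)) = ν :=
    map_prod_gaussianTransport (r := r) hac hp hr₀ hgm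
  -- Both points share one Gaussian variable: the second keeps it, the first moves it by the
  -- transport of its own fibre.
  set G : (A × A) × ℝ → (A × ℝ) × (A × ℝ) :=
    fun q => ((q.1.1, T (q.1.1, q.2)), (q.1.2, q.2)) with hG
  have hGm : Measurable G := by fun_prop
  refine ⟨(π₁.prod stdGaussianReal).map G, ⟨?_, ?_⟩, ?_⟩
  · rw [Measure.fst, Measure.map_map measurable_fst hGm]
    have h1 : (Prod.fst ∘ G) = (fun p : A × ℝ => (p.1, T p)) ∘ Prod.map Prod.fst id := rfl
    rw [h1, ← Measure.map_map hgm (by fun_prop),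
      ← Measure.map_prod_map _ _ measurable_fst measurable_id, Measure.map_id]
    change (π₁.fst.prod stdGaussianReal).map _ = ν
    rw [hπ₁f, hνmap]
  · rw [Measure.snd, Measure.map_map measurable_snd hGm]
    have h1 : (Prod.snd ∘ G) = Prod.map Prod.snd id := rfl
    rw [h1, ← Measure.map_prod_map _ _ measurable_snd measurable_id, Measure.map_id]
    change π₁.snd.prod stdGaussianReal = _
    rw [hπ₁s]
  · have hcm : Measurable fun q : (A × A) × ℝ => c q.1.1 q.1.2 := hc.comp measurable_fst
    have hsm : Measurable fun q : (A × A) × ℝ =>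
        ENNReal.ofReal ((T (q.1.1, q.2) - q.2) ^ 2) := by fun_prop
    have hsm' : Measurable fun p : A × ℝ => ENNReal.ofReal ((T p - p.2) ^ 2) := by fun_prop
    have hm : Measurable fun p : (A × ℝ) × (A × ℝ) =>
        c p.1.1 p.2.1 + ENNReal.ofReal ((p.1.2 - p.2.2) ^ 2) :=
      (hc.comp (f := fun p : (A × ℝ) × (A × ℝ) => (p.1.1, p.2.1)) (by fun_prop)).add
        (by fun_prop)
    rw [lintegral_map hm hGm]
    simp only [hG]
    rw [lintegral_add_left hcm, mul_add]
    gcongr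
    · rw [lintegral_prod _ hcm.aemeasurable]
      simpa using hπ₁c
    · rw [lintegral_prod _ hsm.aemeasurable]
      have h1 : ∫⁻ x, ∫⁻ s, ENNReal.ofReal ((T (x.1, s) - s) ^ 2) ∂stdGaussianReal ∂π₁ =
          ∫⁻ x, ∫⁻ s, ENNReal.ofReal ((T (x, s) - s) ^ 2) ∂stdGaussianReal ∂ν₁ := by
        rw [← hπ₁f, Measure.fst, lintegral_map hsm'.lintegral_prod_right' measurable_fst]
      rw [h1, InformationTheory.klDiv_eq_lintegral_klFun_of_ac hac, lintegral_prod _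
        (by fun_prop), ← lintegral_const_mul' _ _ ENNReal.ofNat_ne_top]
      refine lintegral_mono_ae ?_
      filter_upwards [hr₀] with x hx
      have hpx := hp x
      have key := lintegral_sq_gaussianTransport_sub_le (hrx x)
      simp only [hx]
      exact key

lemma IsCoupling.map {B : Type*} [MeasurableSpace B] {π : Measure (A × A)} {μ ν : Measure A}
    (h : IsCoupling π μ ν) {f g : A → B} (hf : Measurable f) (hg : Measurable g) :
    IsCoupling (π.map (Prod.map f g)) (μ.map f) (ν.map g) := by
  constructor
  · rw [Measure.fst, Measure.map_map measurable_fst (by fun_prop), ← h.1, Measure.fst,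
      Measure.map_map hf measurable_fst]
    rfl
  · rw [Measure.snd, Measure.map_map measurable_snd (by fun_prop), ← h.2, Measure.snd,
      Measure.map_map hg measurable_snd]
    rfl

/-- Pull `ν` back along `e`, which does not increase divergence, and push the resulting coupling
forward. -/
lemma SatisfiesTalagrand.map {B : Type*} [MeasurableSpace B] {μ : Measure A}
    [IsProbabilityMeasure μ] {c : A → A → ℝ≥0∞} (hc : Measurable (Function.uncurry c))
    (h : SatisfiesTalagrand μ c) (e : A ≃ᵐ B) :
    SatisfiesTalagrand (μ.map e) (fun b b' => c (e.symm b) (e.symm b')) := by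
  intro ν hν hfin
  have hμe : IsProbabilityMeasure (μ.map e) :=
    Measure.isProbabilityMeasure_map e.measurable.aemeasurable
  have hνe : IsProbabilityMeasure (ν.map e.symm) :=
    Measure.isProbabilityMeasure_map e.symm.measurable.aemeasurable
  have hle := InformationTheory.klDiv_map_le ν (μ.map e) e.symm.measurable
  rw [e.map_symm_map] at hle
  obtain ⟨π, hπ, hcost⟩ := h _ hνe (ne_top_of_le_ne_top hfin hle)
  refine ⟨π.map (Prod.map e e), ?_, ?_⟩
  · have := hπ.map e.measurable e.measurable
    rwa [e.map_map_symm] at this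
  · have hm : Measurable fun p : B × B => c (e.symm p.1) (e.symm p.2) :=
      hc.comp (f := fun p : B × B => (e.symm p.1, e.symm p.2)) (by fun_prop)
    rw [lintegral_map hm (by fun_prop)]
    simp only [Prod.map_fst, Prod.map_snd, MeasurableEquiv.symm_apply_apply]
    exact hcost.trans (by gcongr)

end Tensor

lemma isCoupling_prod {A B : Type*} [MeasurableSpace A] [MeasurableSpace B] (μ : Measure A)
    (ν : Measure B) [IsProbabilityMeasure μ] [IsProbabilityMeasure ν] :
    IsCoupling (μ.prod ν) μ ν := ⟨Measure.fst_prod, Measure.snd_prod⟩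

lemma satisfiesTalagrand_pi (n : ℕ) :
    SatisfiesTalagrand (Measure.pi fun _ : Fin n => stdGaussianReal)
      (fun z y => ∑ i, ENNReal.ofReal ((z i - y i) ^ 2)) := by
  induction n with
  | zero =>
    intro ν hν _
    exact ⟨_, isCoupling_prod ν _, by simp⟩
  | succ n ih =>
    have h := ih.prod_stdGaussianReal (by unfold Function.uncurry; fun_prop)
    have hmp := measurePreserving_piFinSuccAbove (fun _ : Fin (n + 1) => stdGaussianReal) 0
    -- Coordinate `0` is split off and moved to the right-hand factor, where the product lemma
    -- expects the real variable.
    set e := (MeasurableEquiv.piFinSuccAbove (fun _ : Fin (n + 1) => ℝ) 0).trans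
      MeasurableEquiv.prodComm with he
    have hmap : (Measure.pi fun _ : Fin (n + 1) => stdGaussianReal).map e =
        (Measure.pi fun _ : Fin n => stdGaussianReal).prod stdGaussianReal :=
      (hmp.trans (μc := (Measure.pi fun _ : Fin n => stdGaussianReal).prod stdGaussianReal)
        (e' := MeasurableEquiv.prodComm) Measure.measurePreserving_swap).map_eq
    have h2 := h.map (by unfold Function.uncurry; fun_prop) e.symm
    rw [← hmap, e.map_symm_map] at h2
    convert! h2 using 3
    rw [Fin.sum_univ_succ, add_comm]
    rfl

/-- **Talagrand's inequality** for the standard Gaussian law on `ℝⁿ`. -/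
lemma satisfiesTalagrand_stdGaussian (n : ℕ) :
    SatisfiesTalagrand (stdGaussian (EuclideanSpace ℝ (Fin n)))
      (fun z y => ENNReal.ofReal (‖z - y‖ ^ 2)) := by
  have h := (satisfiesTalagrand_pi n).map (by unfold Function.uncurry; fun_prop)
    (MeasurableEquiv.toLp 2 (Fin n → ℝ))
  rw [MeasurableEquiv.coe_toLp, map_pi_eq_stdGaussian] at h
  convert! h using 3 with z y
  rw [EuclideanSpace.real_norm_sq_eq, ENNReal.ofReal_sum_of_nonneg fun i _ => sq_nonneg _]
  rfl

open scoped RealInnerProductSpace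

/-! ### Isotropic Gaussian laws on `ℝⁿ` and their densities. -/

section Density

variable {n : ℕ}

/-- The logarithm of the Lebesgue density of `N(m, σ² I)` on `ℝⁿ`. -/
noncomputable def logGaussian (m : EuclideanSpace ℝ (Fin n)) (σ : ℝ)
    (x : EuclideanSpace ℝ (Fin n)) : ℝ :=
  -(n / 2) * Real.log (2 * Real.pi * σ ^ 2) - ‖x - m‖ ^ 2 / (2 * σ ^ 2)

@[fun_prop]
lemma continuous_logGaussian (m : EuclideanSpace ℝ (Fin n)) (σ : ℝ) :
    Continuous (logGaussian m σ) := by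
  unfold logGaussian; fun_prop

/-- Centring at `m` puts the integrand in the form of the standard Gaussian Fourier integral; `t =
0` then gives integrability and general `t` the characteristic function. -/
lemma exp_logGaussian_mul_cexp (m t v : EuclideanSpace ℝ (Fin n)) {σ : ℝ} :
    ((Real.exp (logGaussian m σ (v + m)) : ℝ) : ℂ) * Complex.exp (⟪v + m, t⟫ * Complex.I) =
      (Complex.exp (-(n / 2) * (Real.log (2 * Real.pi * σ ^ 2) : ℝ)) *
        Complex.exp (⟪m, t⟫ * Complex.I)) *
      Complex.exp (-((1 / (2 * σ ^ 2) : ℝ) : ℂ) * ‖v‖ ^ 2 + Complex.I * ⟪t, v⟫) := by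
  rw [Complex.ofReal_exp, ← Complex.exp_add, ← Complex.exp_add, ← Complex.exp_add, logGaussian,
    add_sub_cancel_right, inner_add_left, real_inner_comm v t]
  congr 1
  push_cast
  ring

lemma integrable_exp_logGaussian (m : EuclideanSpace ℝ (Fin n)) {σ : ℝ} (hσ : 0 < σ) :
    Integrable fun x => Real.exp (logGaussian m σ x) := by
  have h := (GaussianFourier.integrable_cexp_neg_mul_sq_norm_add
    (V := EuclideanSpace ℝ (Fin n)) (b := ((1 / (2 * σ ^ 2) : ℝ) : ℂ))
    (by rw [Complex.ofReal_re]; positivity) Complex.I 0).const_mul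
      (Complex.exp (-(n / 2) * (Real.log (2 * Real.pi * σ ^ 2) : ℝ)) *
        Complex.exp (⟪m, (0 : EuclideanSpace ℝ (Fin n))⟫ * Complex.I))
  simp_rw [← exp_logGaussian_mul_cexp] at h
  have h2 := (h.comp_sub_right m).re
  refine h2.congr (ae_of_all _ fun x => ?_)
  beta_reduce
  rw [sub_add_cancel, inner_zero_right, Complex.ofReal_zero, zero_mul, Complex.exp_zero, mul_one]
  exact Complex.ofReal_re _

lemma integral_exp_logGaussian_mul_cexp (m t : EuclideanSpace ℝ (Fin n)) {σ : ℝ} (hσ : 0 < σ) :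
    ∫ x, ((Real.exp (logGaussian m σ x) : ℝ) : ℂ) * Complex.exp (⟪x, t⟫ * Complex.I) =
      Complex.exp (⟪m, t⟫ * Complex.I) * Complex.exp (-(σ ^ 2 * ‖t‖ ^ 2) / 2) := by
  rw [← integral_add_right_eq_self _ m]
  simp_rw [exp_logGaussian_mul_cexp]
  rw [integral_const_mul, GaussianFourier.integral_cexp_neg_mul_sq_norm_add
    (by rw [Complex.ofReal_re]; positivity)]
  have hσ' : (σ : ℂ) ≠ 0 := by exact_mod_cast hσ.ne'
  have h1 : (Real.pi / ((1 / (2 * σ ^ 2) : ℝ) : ℂ)) = ((2 * Real.pi * σ ^ 2 : ℝ) : ℂ) := by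
    push_cast; field_simp
  have h2 : ((2 * Real.pi * σ ^ 2 : ℝ) : ℂ) ≠ 0 := by
    exact_mod_cast (show (2 * Real.pi * σ ^ 2 : ℝ) ≠ 0 by positivity)
  rw [h1, Complex.cpow_def_of_ne_zero h2, ← Complex.ofReal_log (by positivity),
    ← Complex.exp_add, ← Complex.exp_add, ← Complex.exp_add, ← Complex.exp_add]
  congr 1
  simp only [finrank_euclideanSpace, Fintype.card_fin, Complex.I_sq]
  push_cast
  field_simp
  ring

/-- The Gaussian law `N(m, σ² I)` on `ℝⁿ`, as an affine image of the standard one. -/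
noncomputable def scaledGaussian (m : EuclideanSpace ℝ (Fin n)) (σ : ℝ) :
    Measure (EuclideanSpace ℝ (Fin n)) :=
  (stdGaussian (EuclideanSpace ℝ (Fin n))).map fun x => m + σ • x

instance (m : EuclideanSpace ℝ (Fin n)) (σ : ℝ) : IsProbabilityMeasure (scaledGaussian m σ) :=
  Measure.isProbabilityMeasure_map (by fun_prop)

lemma scaledGaussian_zero_one :
    scaledGaussian 0 1 = stdGaussian (EuclideanSpace ℝ (Fin n)) := by
  simp [scaledGaussian]

lemma scaledGaussian_eq_withDensity (m : EuclideanSpace ℝ (Fin n)) {σ : ℝ} (hσ : 0 < σ) :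
    scaledGaussian m σ =
      volume.withDensity fun x => ENNReal.ofReal (Real.exp (logGaussian m σ x)) := by
  have := isFiniteMeasure_withDensity_ofReal (integrable_exp_logGaussian m hσ).2
  refine Measure.ext_of_charFun (funext fun t => ?_)
  rw [charFun_apply, charFun_apply, scaledGaussian, integral_map (by fun_prop) (by fun_prop),
    integral_withDensity_eq_integral_toReal_smul (by fun_prop) (by simp)]
  simp_rw [ENNReal.toReal_ofReal (Real.exp_pos _).le, Complex.real_smul]
  rw [integral_exp_logGaussian_mul_cexp m t hσ]
  have h1 : ∀ x : EuclideanSpace ℝ (Fin n), Complex.exp (⟪m + σ • x, t⟫ * Complex.I) =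
      Complex.exp (⟪m, t⟫ * Complex.I) * Complex.exp (⟪x, σ • t⟫ * Complex.I) := fun x => by
    rw [← Complex.exp_add, inner_add_left, real_inner_smul_left, real_inner_smul_right]
    congr 1
    push_cast
    ring
  simp_rw [h1]
  rw [integral_const_mul, ← charFun_apply, charFun_stdGaussian, norm_smul]
  congr 2
  push_cast
  rw [mul_pow, Real.norm_eq_abs, ← Complex.ofReal_pow, sq_abs]
  push_cast
  ring

lemma integral_exp_logGaussian (m : EuclideanSpace ℝ (Fin n)) {σ : ℝ} (hσ : 0 < σ) :
    ∫ x, Real.exp (logGaussian m σ x) = 1 := by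
  have h : scaledGaussian m σ univ = 1 := measure_univ
  rw [scaledGaussian_eq_withDensity m hσ, withDensity_apply _ MeasurableSet.univ,
    setLIntegral_univ, ← ofReal_integral_eq_lintegral_ofReal (integrable_exp_logGaussian m hσ)
      (ae_of_all _ fun _ => (Real.exp_pos _).le)] at h
  simpa using h

/-- As an exponential tilt of Lebesgue measure, the Gaussian law falls under the general formulas
for log-likelihood ratios of tilted measures. -/
lemma scaledGaussian_eq_tilted (m : EuclideanSpace ℝ (Fin n)) {σ : ℝ} (hσ : 0 < σ) :
    scaledGaussian m σ = volume.tilted (logGaussian m σ) := by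
  rw [scaledGaussian_eq_withDensity m hσ, Measure.tilted, integral_exp_logGaussian m hσ]
  simp

lemma stdGaussian_absolutelyContinuous_volume :
    stdGaussian (EuclideanSpace ℝ (Fin n)) ≪ volume := by
  rw [← scaledGaussian_zero_one, scaledGaussian_eq_withDensity 0 one_pos]
  exact withDensity_absolutelyContinuous _ _

lemma memLp_two_stdGaussian :
    MemLp (fun x => x) 2 (stdGaussian (EuclideanSpace ℝ (Fin n))) :=
  IsGaussian.memLp_two_id

lemma integral_norm_sq_stdGaussian :
    ∫ x, ‖x‖ ^ 2 ∂stdGaussian (EuclideanSpace ℝ (Fin n)) = n := by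
  rw [← map_pi_eq_stdGaussian, integral_map (by fun_prop) (by fun_prop)]
  simp_rw [EuclideanSpace.real_norm_sq_eq]
  rw [integral_finsetSum]
  · have h : ∀ i : Fin n, ∫ x : Fin n → ℝ, (x i) ^ 2 ∂Measure.pi (fun _ => gaussianReal 0 1) = 1 :=
      fun i => by
        rw [integral_comp_eval (μ := fun _ : Fin n => gaussianReal 0 1) (i := i)
          (f := fun s : ℝ => s ^ 2) (by fun_prop)]
        exact integral_sq_stdGaussianReal
    simp [h]
  · exact fun i _ => integrable_comp_eval (μ := fun _ : Fin n => gaussianReal 0 1) (i := i)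
      (f := fun s : ℝ => s ^ 2) integrable_sq_stdGaussianReal

lemma integral_inner_stdGaussian (a : EuclideanSpace ℝ (Fin n)) :
    ∫ x, ⟪a, x⟫ ∂stdGaussian (EuclideanSpace ℝ (Fin n)) = 0 := by
  rw [integral_inner (memLp_two_stdGaussian.integrable one_le_two), integral_id_stdGaussian,
    inner_zero_right]

end Density

/-! ### Differential entropy under a second-moment bound. -/

section Entropy

variable {n : ℕ} {μ : Measure (EuclideanSpace ℝ (Fin n))}

lemma differentialEntropy_of_integrable_llr [SigmaFinite μ] (hac : μ ≪ volume)
    (hint : Integrable (llr μ volume) μ) :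
    differentialEntropy μ = ((-∫ x, llr μ volume x ∂μ : ℝ) : EReal) := by
  set g : EuclideanSpace ℝ (Fin n) → ℝ := fun x =>
    Real.negMulLog (μ.rnDeriv volume x).toReal with hg
  have hgi : Integrable g := by
    refine ((integrable_rnDeriv_mul_log_iff hac).2 hint).neg.congr (ae_of_all _ fun x => ?_)
    simp [hg, Real.negMulLog]
  have hval : ∫ x, g x = -∫ x, llr μ volume x ∂μ := by
    rw [← integral_rnDeriv_mul_log hac, ← integral_neg]
    refine integral_congr_ae (ae_of_all _ fun x => ?_)
    simp [hg, Real.negMulLog]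
  have hA : ∫⁻ x, ENNReal.ofReal (g x) ≠ ∞ := hgi.lintegral_lt_top.ne
  have hB : ∫⁻ x, ENNReal.ofReal (-g x) ≠ ∞ := hgi.neg.lintegral_lt_top.ne
  rw [differentialEntropy, if_pos hac, ← hval,
    integral_eq_lintegral_pos_part_sub_lintegral_neg_part hgi, EReal.coe_sub,
    EReal.coe_ennreal_toReal hA, EReal.coe_ennreal_toReal hB]

/-- A law with a density and a finite second moment has entropy `-∞` or integrable log-density. -/
lemma differentialEntropy_eq_bot_or [SigmaFinite μ] (hac : μ ≪ volume) (hmom : MemLp (fun x => x) 2 μ) :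
    differentialEntropy μ = ⊥ ∨ Integrable (llr μ volume) μ := by
  set g : EuclideanSpace ℝ (Fin n) → ℝ := fun x =>
    Real.negMulLog (μ.rnDeriv volume x).toReal with hg
  have hgm : Measurable g := by fun_prop
  have hsq : Integrable (fun x => ‖x‖ ^ 2 / 2) μ := (hmom.integrable_norm_pow two_ne_zero).div_const 2
  have h1 := (integrable_rnDeriv_smul_iff hac).2 hsq
  have h2 : Integrable fun x : EuclideanSpace ℝ (Fin n) => Real.exp (-(‖x‖ ^ 2 / 2)) := by
    refine ((integrable_exp_logGaussian 0 one_pos).const_mul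
      (Real.exp ((n / 2) * Real.log (2 * Real.pi)))).congr (ae_of_all _ fun x => ?_)
    simp only [← Real.exp_add, logGaussian]
    congr 1
    simp only [sub_zero, one_pow, mul_one]
    ring
  -- The Gibbs inequality against `e^(-‖x‖²/2)` bounds `-f log f` by `f ‖x‖²/2 + e^(-‖x‖²/2)`, which
  -- rules out entropy `+∞`.
  have hA : ∫⁻ x, ENNReal.ofReal (g x) ≠ ∞ := by
    refine ne_top_of_le_ne_top (h1.add h2).lintegral_lt_top.ne (lintegral_mono fun x =>
      ENNReal.ofReal_le_ofReal ?_)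
    have := mul_one_add_log_sub_log_le (x := (μ.rnDeriv volume x).toReal) ENNReal.toReal_nonneg
      (Real.exp_pos (-(‖x‖ ^ 2 / 2))).le fun _ => Real.exp_pos _
    rw [Real.log_exp] at this
    simp only [hg, Real.negMulLog, Pi.add_apply, smul_eq_mul]
    nlinarith [ENNReal.toReal_nonneg (a := μ.rnDeriv volume x)]
  by_cases hB : ∫⁻ x, ENNReal.ofReal (-g x) = ∞
  · left
    rw [differentialEntropy, if_pos hac, hB]
    rw [EReal.coe_ennreal_top, sub_eq_add_neg, EReal.neg_top, EReal.add_bot]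
  · right
    rw [← integrable_rnDeriv_mul_log_iff hac]
    have hgi : Integrable g := by
      refine ⟨hgm.aestronglyMeasurable, ?_⟩
      rw [hasFiniteIntegral_iff_norm]
      have hle : ∀ x, ENNReal.ofReal ‖g x‖ ≤ ENNReal.ofReal (g x) + ENNReal.ofReal (-g x) := by
        intro x
        rcases le_total 0 (g x) with h | h
        · rw [Real.norm_of_nonneg h]; exact le_self_add
        · rw [Real.norm_of_nonpos h]; exact le_add_self
      refine (lintegral_mono hle).trans_lt ?_
      rw [lintegral_add_left (by fun_prop)]
      exact ENNReal.add_lt_top.2 ⟨hA.lt_top, lt_top_iff_ne_top.2 hB⟩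
    refine hgi.neg.congr (ae_of_all _ fun x => ?_)
    simp [hg, Real.negMulLog]

end Entropy

lemma integrable_inner_of_memLp {E Ω : Type*} [NormedAddCommGroup E]
    [InnerProductSpace ℝ E] [MeasurableSpace Ω] {Q : Measure Ω} {X Y : Ω → E}
    (hX : MemLp X 2 Q) (hY : MemLp Y 2 Q) : Integrable (fun ω => ⟪X ω, Y ω⟫) Q := by
  refine ((hX.integrable_norm_pow two_ne_zero).add (hY.integrable_norm_pow two_ne_zero)).mono'
    (hX.1.inner hY.1) (ae_of_all _ fun ω => ?_)
  refine (norm_inner_le_norm (𝕜 := ℝ) _ _).trans ?_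
  simp only [Pi.add_apply]
  nlinarith [sq_nonneg (‖X ω‖ - ‖Y ω‖), sq_nonneg (‖X ω‖ + ‖Y ω‖)]

/-! ### Second moments of couplings. -/

section Coupling

variable {E : Type*} [NormedAddCommGroup E] [MeasurableSpace E]
  {P : Measure (E × E)} {μ ν : Measure E}

lemma IsCoupling.memLp_fst (h : IsCoupling P μ ν) (hμ : MemLp (fun x => x) 2 μ) :
    MemLp (fun p : E × E => p.1) 2 P := by
  rw [← h.1] at hμ
  exact hμ.comp_of_map measurable_fst.aemeasurable

lemma IsCoupling.memLp_snd (h : IsCoupling P μ ν) (hν : MemLp (fun x => x) 2 ν) :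
    MemLp (fun p : E × E => p.2) 2 P := by
  rw [← h.2] at hν
  exact hν.comp_of_map measurable_snd.aemeasurable

lemma IsCoupling.integral_norm_sq_fst (h : IsCoupling P μ ν) (hμ : MemLp (fun x => x) 2 μ) :
    ∫ p, ‖p.1‖ ^ 2 ∂P = ∫ x, ‖x‖ ^ 2 ∂μ := by
  rw [← h.1] at hμ ⊢
  rw [Measure.fst, integral_map measurable_fst.aemeasurable]
  exact (hμ.integrable_norm_pow two_ne_zero).1

lemma IsCoupling.integral_norm_sq_snd (h : IsCoupling P μ ν) (hν : MemLp (fun x => x) 2 ν) :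
    ∫ p, ‖p.2‖ ^ 2 ∂P = ∫ x, ‖x‖ ^ 2 ∂ν := by
  rw [← h.2] at hν ⊢
  rw [Measure.snd, integral_map measurable_snd.aemeasurable]
  exact (hν.integrable_norm_pow two_ne_zero).1

lemma IsCoupling.integrable_norm_sub_sq (h : IsCoupling P μ ν) (hμ : MemLp (fun x => x) 2 μ)
    (hν : MemLp (fun x => x) 2 ν) : Integrable (fun p => ‖p.1 - p.2‖ ^ 2) P :=
  ((h.memLp_fst hμ).sub (h.memLp_snd hν)).integrable_norm_pow two_ne_zero

variable [InnerProductSpace ℝ E]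

lemma IsCoupling.integrable_inner (h : IsCoupling P μ ν) (hμ : MemLp (fun x => x) 2 μ)
    (hν : MemLp (fun x => x) 2 ν) : Integrable (fun p => ⟪p.1, p.2⟫) P :=
  integrable_inner_of_memLp (h.memLp_fst hμ) (h.memLp_snd hν)

lemma IsCoupling.integral_norm_sub_sq (h : IsCoupling P μ ν) (hμ : MemLp (fun x => x) 2 μ)
    (hν : MemLp (fun x => x) 2 ν) :
    ∫ p, ‖p.1 - p.2‖ ^ 2 ∂P =
      ∫ x, ‖x‖ ^ 2 ∂μ + ∫ y, ‖y‖ ^ 2 ∂ν - 2 * ∫ p, ⟪p.1, p.2⟫ ∂P := by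
  have h1 : Integrable (fun p : E × E => ‖p.1‖ ^ 2) P :=
    (h.memLp_fst hμ).integrable_norm_pow two_ne_zero
  have h2 : Integrable (fun p : E × E => ‖p.2‖ ^ 2) P :=
    (h.memLp_snd hν).integrable_norm_pow two_ne_zero
  have h3 : Integrable (fun p : E × E => 2 * ⟪p.1, p.2⟫) P := (h.integrable_inner hμ hν).const_mul 2
  have h4 : Integrable (fun p : E × E => ‖p.1‖ ^ 2 - 2 * ⟪p.1, p.2⟫) P := h1.sub h3
  simp_rw [norm_sub_sq_real]
  rw [integral_add h4 h2, integral_sub h1 h3, integral_const_mul, h.integral_norm_sq_fst hμ,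
    h.integral_norm_sq_snd hν]
  ring

end Coupling

/-! ### Correlation from entropy power. -/

section ScaledTalagrand

variable {n : ℕ} {μ : Measure (EuclideanSpace ℝ (Fin n))} [IsProbabilityMeasure μ]

lemma integrable_logGaussian (hmom : MemLp (fun x => x) 2 μ) (m : EuclideanSpace ℝ (Fin n))
    (σ : ℝ) : Integrable (logGaussian m σ) μ := by
  unfold logGaussian
  exact (integrable_const _).sub
    (((hmom.sub (memLp_const m)).integrable_norm_pow two_ne_zero).div_const _)

lemma integral_logGaussian_zero (hmom : MemLp (fun x => x) 2 μ) (σ : ℝ) :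
    ∫ x, logGaussian 0 σ x ∂μ =
      -(n / 2) * Real.log (2 * Real.pi * σ ^ 2) - (∫ x, ‖x‖ ^ 2 ∂μ) / (2 * σ ^ 2) := by
  unfold logGaussian
  simp only [sub_zero]
  rw [integral_sub (integrable_const _)
    ((hmom.integrable_norm_pow two_ne_zero).div_const _), integral_div]
  simp

/-- The log-likelihood ratio relative to a tilt of `volume` is the ratio relative to `volume` minus
the tilting exponent, and the normalising integral is `1`. -/
lemma klDiv_scaledGaussian (hac : μ ≪ volume) (hint : Integrable (llr μ volume) μ)
    (hmom : MemLp (fun x => x) 2 μ) (m : EuclideanSpace ℝ (Fin n)) {σ : ℝ} (hσ : 0 < σ) :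
    klDiv μ (scaledGaussian m σ) ≠ ∞ ∧ (klDiv μ (scaledGaussian m σ)).toReal =
      ∫ x, llr μ volume x ∂μ - ∫ x, logGaussian m σ x ∂μ := by
  have hexp := integrable_exp_logGaussian m hσ
  have hlog := integrable_logGaussian hmom m σ
  have hac' : μ ≪ scaledGaussian m σ := by
    rw [scaledGaussian_eq_tilted m hσ]
    exact hac.trans (absolutelyContinuous_tilted hexp)
  have hint' : Integrable (llr μ (scaledGaussian m σ)) μ := by
    rw [scaledGaussian_eq_tilted m hσ]
    exact integrable_llr_tilted_right hac hlog hint hexp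
  refine ⟨InformationTheory.klDiv_ne_top hac' hint', ?_⟩
  rw [InformationTheory.toReal_klDiv_of_measure_eq hac' (by simp), scaledGaussian_eq_tilted m hσ,
    integral_llr_tilted_right hac hlog hexp hint, integral_exp_logGaussian m hσ]
  simp

/-- Talagrand's inequality, optimised over dilations of `μ`: the standard Gaussian law has a
coupling with `μ` whose correlation is bounded below by the entropy power of `μ`. -/
lemma exists_coupling_le_integral_inner (hn : 1 ≤ n) (hac : μ ≪ volume)
    (hint : Integrable (llr μ volume) μ) (hmom : MemLp (fun x => x) 2 μ) :
    ∃ π, IsCoupling π μ (stdGaussian (EuclideanSpace ℝ (Fin n))) ∧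
      n * Real.exp (-(∫ x, llr μ volume x ∂μ) / n - 1 / 2 - Real.log (2 * Real.pi) / 2) ≤
        ∫ p, ⟪p.1, p.2⟫ ∂π := by
  have hn0 : (0 : ℝ) < n := by exact_mod_cast hn
  set H := -∫ x, llr μ volume x ∂μ with hH
  -- Chosen so that `H + n l = (n/2) log (2πe)`: dilation by `a = e^l` gives `μ` the entropy of the
  -- standard Gaussian.
  set l := 1 / 2 + Real.log (2 * Real.pi) / 2 - H / n with hl
  set a := Real.exp l with ha
  have ha0 : 0 < a := Real.exp_pos _
  have hb0 : 0 < a⁻¹ := inv_pos.2 ha0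
  set γ := stdGaussian (EuclideanSpace ℝ (Fin n)) with hγ
  have hγmap : (scaledGaussian (0 : EuclideanSpace ℝ (Fin n)) a⁻¹).map (fun x => a • x) = γ := by
    rw [scaledGaussian, Measure.map_map (by fun_prop) (by fun_prop)]
    have : (fun x : EuclideanSpace ℝ (Fin n) => a • x) ∘ (fun x => 0 + a⁻¹ • x) = id := by
      ext1 x; simp [smul_smul, ha0.ne']
    rw [this, Measure.map_id]
  obtain ⟨hkl, hklval⟩ := klDiv_scaledGaussian hac hint hmom 0 hb0
  have hle : klDiv (μ.map fun x => a • x) γ ≤ klDiv μ (scaledGaussian 0 a⁻¹) := by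
    rw [← hγmap]
    exact InformationTheory.klDiv_map_le _ _ (by fun_prop)
  have hμa : IsProbabilityMeasure (μ.map fun x => a • x) :=
    Measure.isProbabilityMeasure_map (by fun_prop)
  obtain ⟨π, hπ, hcost⟩ := satisfiesTalagrand_stdGaussian n _ hμa (ne_top_of_le_ne_top hkl hle)
  have hπ' : IsCoupling (π.map (Prod.map (fun x => a⁻¹ • x) id)) μ γ := by
    have := hπ.map (f := fun x => a⁻¹ • x) (g := id) (by fun_prop) measurable_id
    rw [Measure.map_map (by fun_prop) (by fun_prop), Measure.map_id] at this
    have h2 : (fun x : EuclideanSpace ℝ (Fin n) => a⁻¹ • x) ∘ (fun x => a • x) = id := by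
      ext1 x; simp [smul_smul, ha0.ne']
    rwa [h2, Measure.map_id] at this
  refine ⟨_, hπ', ?_⟩
  have hmoma : MemLp (fun x => x) 2 (μ.map fun x => a • x) :=
    (memLp_map_measure_iff (by fun_prop) (by fun_prop)).2 (hmom.const_smul a)
  have hmomγ : MemLp (fun x => x) 2 γ := memLp_two_stdGaussian
  have hreal : ∫ p, ‖p.1 - p.2‖ ^ 2 ∂π ≤ 2 * (klDiv μ (scaledGaussian 0 a⁻¹)).toReal := by
    rw [integral_eq_lintegral_of_nonneg_ae (ae_of_all _ fun p => sq_nonneg _)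
      (hπ.integrable_norm_sub_sq hmoma hmomγ).1]
    have := ENNReal.toReal_mono (ENNReal.mul_ne_top ENNReal.ofNat_ne_top hkl)
      (hcost.trans (mul_le_mul_right hle 2))
    simpa using this
  rw [hπ.integral_norm_sub_sq hmoma hmomγ, hklval, integral_logGaussian_zero hmom,
    integral_norm_sq_stdGaussian, integral_map (by fun_prop) (by fun_prop)] at hreal
  simp_rw [norm_smul, mul_pow] at hreal
  rw [integral_const_mul, Real.norm_of_nonneg ha0.le] at hreal
  have hinner : ∫ p, ⟪p.1, p.2⟫ ∂(π.map (Prod.map (fun x => a⁻¹ • x) id)) =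
      a⁻¹ * ∫ p, ⟪p.1, p.2⟫ ∂π := by
    rw [integral_map (by fun_prop) (by fun_prop), ← integral_const_mul]
    simp [real_inner_smul_left]
  have hlogb : Real.log (2 * Real.pi * a⁻¹ ^ 2) = Real.log (2 * Real.pi) - 2 * l := by
    rw [Real.log_mul (by positivity) (by positivity), Real.log_pow, Real.log_inv, ha, Real.log_exp]
    push_cast; ring
  have hnl : n * l = n / 2 + n * Real.log (2 * Real.pi) / 2 - H := by
    rw [hl]; field_simp
  have hfr : (∫ x, ‖x‖ ^ 2 ∂μ) / (2 * a⁻¹ ^ 2) = a ^ 2 * (∫ x, ‖x‖ ^ 2 ∂μ) / 2 := by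
    field_simp
  -- The second moment of `μ` now appears with the same coefficient `a²` on both sides and cancels,
  -- leaving correlation at least `n` for the dilated law.
  rw [hlogb, hfr] at hreal
  have hexp : Real.exp (H / n - 1 / 2 - Real.log (2 * Real.pi) / 2) = a⁻¹ := by
    rw [ha, ← Real.exp_neg, hl]; congr 1; ring
  rw [hinner, hexp, mul_comm]
  refine mul_le_mul_of_nonneg_left ?_ hb0.le
  nlinarith

end ScaledTalagrand

/-! ### The additive Gaussian channel. -/

section Channel

variable {n : ℕ}

/-- The logarithm of the density, relative to `N(0, I) ⊗ N(0, I)`, of the law of two jointly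
standard Gaussian vectors on `ℝⁿ` with coordinatewise correlation `ρ`. -/
noncomputable def logMehler (ρ : ℝ) (p : EuclideanSpace ℝ (Fin n) × EuclideanSpace ℝ (Fin n)) : ℝ :=
  -(n / 2) * Real.log (1 - ρ ^ 2) -
    (ρ ^ 2 * (‖p.1‖ ^ 2 + ‖p.2‖ ^ 2) - 2 * ρ * ⟪p.1, p.2⟫) / (2 * (1 - ρ ^ 2))

@[fun_prop]
lemma continuous_logMehler (ρ : ℝ) : Continuous (logMehler (n := n) ρ) := by
  unfold logMehler; fun_prop

/-- Completing the square: given the first vector `a`, the second has law `N(ρa, (1 - ρ²) I)`. -/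
lemma logGaussian_add_logMehler {ρ : ℝ} (hρ : ρ ^ 2 < 1) (a y : EuclideanSpace ℝ (Fin n)) :
    logGaussian 0 1 y + logMehler ρ (a, y) = logGaussian (ρ • a) √(1 - ρ ^ 2) y := by
  have h : 0 < 1 - ρ ^ 2 := by linarith
  simp only [logGaussian, logMehler, Real.sq_sqrt h.le, sub_zero, one_pow, mul_one]
  rw [Real.log_mul (by positivity) h.ne', norm_sub_sq_real, real_inner_smul_right, norm_smul,
    mul_pow, Real.norm_eq_abs, sq_abs, real_inner_comm]
  field_simp
  ring

lemma scaledGaussian_eq_withDensity_logMehler {ρ : ℝ} (hρ : ρ ^ 2 < 1)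
    (a : EuclideanSpace ℝ (Fin n)) :
    scaledGaussian (ρ • a) √(1 - ρ ^ 2) =
      (stdGaussian (EuclideanSpace ℝ (Fin n))).withDensity
        fun y => ENNReal.ofReal (Real.exp (logMehler ρ (a, y))) := by
  rw [scaledGaussian_eq_withDensity _ (Real.sqrt_pos.2 (by linarith)), ← scaledGaussian_zero_one,
    scaledGaussian_eq_withDensity _ one_pos, ← withDensity_mul _ (by fun_prop) (by fun_prop)]
  congr 1
  ext1 y
  rw [Pi.mul_apply, ← ENNReal.ofReal_mul (Real.exp_pos _).le, ← Real.exp_add,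
    logGaussian_add_logMehler hρ]

lemma lintegral_exp_logMehler {ρ : ℝ} (hρ : ρ ^ 2 < 1) (a : EuclideanSpace ℝ (Fin n)) :
    ∫⁻ y, ENNReal.ofReal (Real.exp (logMehler ρ (a, y)))
      ∂stdGaussian (EuclideanSpace ℝ (Fin n)) = 1 := by
  rw [← setLIntegral_univ, ← withDensity_apply _ MeasurableSet.univ,
    ← scaledGaussian_eq_withDensity_logMehler hρ]
  exact measure_univ

/-- The expectation of `logMehler` under a coupling of two standard Gaussian laws. -/
lemma IsCoupling.integral_logMehler
    {P : Measure (EuclideanSpace ℝ (Fin n) × EuclideanSpace ℝ (Fin n))}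
    (h : IsCoupling P (stdGaussian _) (stdGaussian _)) (ρ : ℝ) :
    Integrable (logMehler ρ) P ∧ ∫ p, logMehler ρ p ∂P = -(n / 2) * Real.log (1 - ρ ^ 2) -
      (2 * n * ρ ^ 2 - 2 * ρ * ∫ p, ⟪p.1, p.2⟫ ∂P) / (2 * (1 - ρ ^ 2)) := by
  have := h.isProbabilityMeasure
  have h1 : Integrable (fun p : EuclideanSpace ℝ (Fin n) × EuclideanSpace ℝ (Fin n) =>
      ‖p.1‖ ^ 2) P := (h.memLp_fst memLp_two_stdGaussian).integrable_norm_pow two_ne_zero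
  have h2 : Integrable (fun p : EuclideanSpace ℝ (Fin n) × EuclideanSpace ℝ (Fin n) =>
      ‖p.2‖ ^ 2) P := (h.memLp_snd memLp_two_stdGaussian).integrable_norm_pow two_ne_zero
  have h3 := h.integrable_inner memLp_two_stdGaussian memLp_two_stdGaussian
  have h4 : Integrable (fun p : EuclideanSpace ℝ (Fin n) × EuclideanSpace ℝ (Fin n) =>
      ρ ^ 2 * (‖p.1‖ ^ 2 + ‖p.2‖ ^ 2)) P := (h1.add h2).const_mul _
  have h5 : Integrable (fun p : EuclideanSpace ℝ (Fin n) × EuclideanSpace ℝ (Fin n) =>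
      (ρ ^ 2 * (‖p.1‖ ^ 2 + ‖p.2‖ ^ 2) - 2 * ρ * ⟪p.1, p.2⟫) / (2 * (1 - ρ ^ 2))) P :=
    (h4.sub (h3.const_mul _)).div_const _
  unfold logMehler
  refine ⟨(integrable_const _).sub h5, ?_⟩
  rw [integral_sub (integrable_const _) h5, integral_div, integral_sub h4 (h3.const_mul _),
    integral_const_mul (ρ ^ 2), integral_const_mul (2 * ρ), integral_add h1 h2,
    h.integral_norm_sq_fst memLp_two_stdGaussian, h.integral_norm_sq_snd memLp_two_stdGaussian,
    integral_norm_sq_stdGaussian]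
  simp only [integral_const, probReal_univ, one_smul]
  ring

lemma map_add_smul_prod_stdGaussian {ρ : ℝ} (hρ : ρ ^ 2 < 1) :
    ((stdGaussian (EuclideanSpace ℝ (Fin n))).prod (stdGaussian (EuclideanSpace ℝ (Fin n)))).map
      (fun q => ρ • q.1 + √(1 - ρ ^ 2) • q.2) = stdGaussian (EuclideanSpace ℝ (Fin n)) := by
  have := Measure.isProbabilityMeasure_map
    (μ := (stdGaussian (EuclideanSpace ℝ (Fin n))).prod (stdGaussian (EuclideanSpace ℝ (Fin n))))
    (f := fun q => ρ • q.1 + √(1 - ρ ^ 2) • q.2) (by fun_prop)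
  refine Measure.ext_of_charFun (funext fun t => ?_)
  rw [charFun_apply, integral_map (by fun_prop) (by fun_prop)]
  have h1 : ∀ q : EuclideanSpace ℝ (Fin n) × EuclideanSpace ℝ (Fin n),
      Complex.exp (⟪ρ • q.1 + √(1 - ρ ^ 2) • q.2, t⟫ * Complex.I) =
      Complex.exp (⟪q.1, ρ • t⟫ * Complex.I) *
        Complex.exp (⟪q.2, √(1 - ρ ^ 2) • t⟫ * Complex.I) := fun q => by
    rw [← Complex.exp_add, inner_add_left, real_inner_smul_left, real_inner_smul_left,
      real_inner_smul_right, real_inner_smul_right]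
    congr 1
    push_cast
    ring
  simp_rw [h1]
  rw [integral_prod_mul (fun x => Complex.exp (⟪x, ρ • t⟫ * Complex.I))
    (fun x => Complex.exp (⟪x, √(1 - ρ ^ 2) • t⟫ * Complex.I)), ← charFun_apply, ← charFun_apply,
    charFun_stdGaussian, charFun_stdGaussian, charFun_stdGaussian, ← Complex.exp_add, norm_smul,
    norm_smul, ← Complex.ofReal_pow, ← Complex.ofReal_pow, ← Complex.ofReal_pow, mul_pow, mul_pow,
    Real.norm_eq_abs, Real.norm_eq_abs, sq_abs, sq_abs, Real.sq_sqrt (by linarith)]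
  congr 1
  push_cast
  ring

/-- Replace the second component of a pair by its image under the additive Gaussian channel with
correlation `ρ`. -/
noncomputable def noisyCoupling (ρ : ℝ)
    (π : Measure (EuclideanSpace ℝ (Fin n) × EuclideanSpace ℝ (Fin n))) :
    Measure (EuclideanSpace ℝ (Fin n) × EuclideanSpace ℝ (Fin n)) :=
  (π.prod (stdGaussian (EuclideanSpace ℝ (Fin n)))).map
    fun q => (q.1.1, ρ • q.1.2 + √(1 - ρ ^ 2) • q.2)

variable {π : Measure (EuclideanSpace ℝ (Fin n) × EuclideanSpace ℝ (Fin n))}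
  {μ : Measure (EuclideanSpace ℝ (Fin n))} [IsProbabilityMeasure μ] {ρ : ℝ}

lemma IsCoupling.noisyCoupling (h : IsCoupling π μ (stdGaussian _)) (hρ : ρ ^ 2 < 1) :
    IsCoupling (noisyCoupling ρ π) μ (stdGaussian _) := by
  have := h.isProbabilityMeasure
  constructor
  · rw [Measure.fst, InfoOT.noisyCoupling, Measure.map_map measurable_fst (by fun_prop)]
    have h1 : (Prod.fst ∘ fun q : (EuclideanSpace ℝ (Fin n) × EuclideanSpace ℝ (Fin n)) ×
        EuclideanSpace ℝ (Fin n) => (q.1.1, ρ • q.1.2 + √(1 - ρ ^ 2) • q.2)) =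
        Prod.fst ∘ Prod.fst := rfl
    rw [h1, ← Measure.map_map measurable_fst measurable_fst]
    change (Measure.fst (Measure.fst _)) = μ
    rw [Measure.fst_prod, h.1]
  · rw [Measure.snd, InfoOT.noisyCoupling, Measure.map_map measurable_snd (by fun_prop)]
    have h1 : (Prod.snd ∘ fun q : (EuclideanSpace ℝ (Fin n) × EuclideanSpace ℝ (Fin n)) ×
        EuclideanSpace ℝ (Fin n) => (q.1.1, ρ • q.1.2 + √(1 - ρ ^ 2) • q.2)) =
        (fun q => ρ • q.1 + √(1 - ρ ^ 2) • q.2) ∘ Prod.map Prod.snd id := rfl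
    rw [h1, ← Measure.map_map (by fun_prop) (by fun_prop),
      ← Measure.map_prod_map _ _ measurable_snd measurable_id, Measure.map_id]
    change (π.snd.prod _).map _ = _
    rw [h.2, map_add_smul_prod_stdGaussian hρ]

lemma IsCoupling.integral_inner_noisyCoupling (h : IsCoupling π μ (stdGaussian _))
    (hmom : MemLp (fun x => x) 2 μ) :
    ∫ p, ⟪p.1, p.2⟫ ∂InfoOT.noisyCoupling ρ π = ρ * ∫ p, ⟪p.1, p.2⟫ ∂π := by
  have := h.isProbabilityMeasure
  have h1 : Integrable (fun q : (EuclideanSpace ℝ (Fin n) × EuclideanSpace ℝ (Fin n)) ×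
      EuclideanSpace ℝ (Fin n) => ⟪q.1.1, q.1.2⟫) (π.prod (stdGaussian _)) :=
    (h.integrable_inner hmom memLp_two_stdGaussian).comp_fst _
  have h2 : Integrable (fun q : (EuclideanSpace ℝ (Fin n) × EuclideanSpace ℝ (Fin n)) ×
      EuclideanSpace ℝ (Fin n) => ⟪q.1.1, q.2⟫) (π.prod (stdGaussian _)) :=
    integrable_inner_of_memLp ((h.memLp_fst hmom).comp_fst _) (memLp_two_stdGaussian.comp_snd _)
  rw [InfoOT.noisyCoupling, integral_map (by fun_prop) (by fun_prop)]
  simp_rw [inner_add_right, real_inner_smul_right]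
  rw [integral_add (h1.const_mul _) (h2.const_mul _), integral_const_mul, integral_const_mul,
    integral_prod _ h1, integral_prod _ h2]
  simp [integral_inner_stdGaussian]

end Channel

/-! ### Computing and bounding divergences by log-densities. -/

/-- The divergence of a law given by an explicit log-density. -/
lemma klDiv_withDensity_exp {Ω : Type*} [MeasurableSpace Ω] {P Q : Measure Ω}
    [IsProbabilityMeasure P] [IsProbabilityMeasure Q] {L : Ω → ℝ} (hL : Measurable L)
    (hP : P = Q.withDensity fun x => ENNReal.ofReal (Real.exp (L x))) (hint : Integrable L P) :
    klDiv P Q = ENNReal.ofReal (∫ x, L x ∂P) := by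
  have hac : P ≪ Q := hP ▸ withDensity_absolutelyContinuous _ _
  have hllr : llr P Q =ᵐ[P] L := by
    refine hac.ae_le ?_
    rw [hP]
    filter_upwards [Measure.rnDeriv_withDensity Q
      (f := fun x => ENNReal.ofReal (Real.exp (L x))) (by fun_prop)] with x hx
    rw [llr, hx, ENNReal.toReal_ofReal (Real.exp_pos _).le, Real.log_exp]
  rw [InformationTheory.klDiv_of_ac_of_integrable hac ((integrable_congr hllr).2 hint),
    integral_congr_ae hllr]
  simp

/-- The **Donsker-Varadhan** inequality for a normalised test function. -/
lemma integral_le_toReal_klDiv {Ω : Type*} [MeasurableSpace Ω] {P Q : Measure Ω}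
    [IsProbabilityMeasure P] [IsProbabilityMeasure Q] {f : Ω → ℝ} (hf : Integrable f P)
    (hfm : AEMeasurable f Q) (hexp : ∫⁻ x, ENNReal.ofReal (Real.exp (f x)) ∂Q = 1)
    (hfin : klDiv P Q ≠ ∞) : ∫ x, f x ∂P ≤ (klDiv P Q).toReal := by
  obtain ⟨hac, hint⟩ := InformationTheory.klDiv_ne_top_iff.1 hfin
  have hexpi : Integrable (fun x => Real.exp (f x)) Q :=
    (lintegral_ofReal_ne_top_iff_integrable hfm.exp.aestronglyMeasurable
      (ae_of_all _ fun _ => (Real.exp_pos _).le)).1 (by simp [hexp])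
  have hone : ∫ x, Real.exp (f x) ∂Q = 1 := by
    rw [integral_eq_lintegral_of_nonneg_ae (ae_of_all _ fun _ => (Real.exp_pos _).le) hexpi.1, hexp]
    simp
  have := isProbabilityMeasure_tilted hexpi
  have h := InformationTheory.integral_llr_add_sub_measure_univ_nonneg
    (hac.trans (absolutelyContinuous_tilted hexpi)) (integrable_llr_tilted_right hac hf hint hexpi)
  rw [integral_llr_tilted_right hac hf hexpi hint, hone] at h
  rw [InformationTheory.toReal_klDiv_of_measure_eq hac (by simp)]
  simp only [Real.log_one, probReal_univ] at h
  linarith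

/-! ### Information and correlation: achievability and converse. -/

section Channel

variable {n : ℕ} {π : Measure (EuclideanSpace ℝ (Fin n) × EuclideanSpace ℝ (Fin n))}
  {μ : Measure (EuclideanSpace ℝ (Fin n))} {ρ : ℝ}

lemma map_channel_eq_withDensity [IsProbabilityMeasure π] (hρ : ρ ^ 2 < 1) :
    (π.prod (stdGaussian (EuclideanSpace ℝ (Fin n)))).map
        (fun q => (q.1, ρ • q.1.2 + √(1 - ρ ^ 2) • q.2)) =
      (π.prod (stdGaussian (EuclideanSpace ℝ (Fin n)))).withDensity
        fun q => ENNReal.ofReal (Real.exp (logMehler ρ (q.1.2, q.2))) := by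
  ext B hB
  have hm : Measurable fun q : (EuclideanSpace ℝ (Fin n) × EuclideanSpace ℝ (Fin n)) ×
      EuclideanSpace ℝ (Fin n) => (q.1, ρ • q.1.2 + √(1 - ρ ^ 2) • q.2) := by fun_prop
  have hd : Measurable fun q : (EuclideanSpace ℝ (Fin n) × EuclideanSpace ℝ (Fin n)) ×
      EuclideanSpace ℝ (Fin n) => ENNReal.ofReal (Real.exp (logMehler ρ (q.1.2, q.2))) := by
    fun_prop
  rw [Measure.map_apply hm hB, Measure.prod_apply (hm hB), withDensity_apply _ hB,
    ← lintegral_indicator hB, lintegral_prod _ (hd.indicator hB).aemeasurable]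
  refine lintegral_congr fun p => ?_
  have hsec : MeasurableSet (Prod.mk p ⁻¹' B) := measurable_prodMk_left hB
  have h1 : Prod.mk p ⁻¹' ((fun q : (EuclideanSpace ℝ (Fin n) × EuclideanSpace ℝ (Fin n)) ×
      EuclideanSpace ℝ (Fin n) => (q.1, ρ • q.1.2 + √(1 - ρ ^ 2) • q.2)) ⁻¹' B) =
      (fun x => ρ • p.2 + √(1 - ρ ^ 2) • x) ⁻¹' (Prod.mk p ⁻¹' B) := rfl
  rw [h1, ← Measure.map_apply (by fun_prop) hsec]
  change scaledGaussian (ρ • p.2) √(1 - ρ ^ 2) _ = _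
  rw [scaledGaussian_eq_withDensity_logMehler hρ, withDensity_apply _ hsec,
    ← lintegral_indicator hsec]
  refine lintegral_congr fun y => ?_
  by_cases hy : (p, y) ∈ B
  · rw [indicator_of_mem hy, indicator_of_mem (show y ∈ Prod.mk p ⁻¹' B from hy)]
  · rw [indicator_of_notMem hy, indicator_of_notMem (show y ∉ Prod.mk p ⁻¹' B from hy)]

/-- Applying the channel to this diagonal coupling yields its input-output pair, so the general
formulas for `noisyCoupling` and `logMehler` apply to it. -/
lemma isCoupling_map_snd_snd (h : IsCoupling π μ (stdGaussian _)) :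
    IsCoupling (π.map fun p => (p.2, p.2)) (stdGaussian (EuclideanSpace ℝ (Fin n)))
      (stdGaussian (EuclideanSpace ℝ (Fin n))) := by
  constructor
  · rw [Measure.fst, Measure.map_map measurable_fst (by fun_prop)]
    exact h.2
  · rw [Measure.snd, Measure.map_map measurable_snd (by fun_prop)]
    exact h.2

variable [IsProbabilityMeasure μ]

/-- The information passed by the additive Gaussian channel bounds that of the noisy coupling. -/
lemma IsCoupling.mutualInfo_noisyCoupling_le (h : IsCoupling π μ (stdGaussian _))
    (hρ : ρ ^ 2 < 1) :
    mutualInfo (InfoOT.noisyCoupling ρ π) ≤ ENNReal.ofReal (-(n / 2) * Real.log (1 - ρ ^ 2)) := by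
  have := h.isProbabilityMeasure
  set γ := stdGaussian (EuclideanSpace ℝ (Fin n)) with hγ
  -- The triple `((Z, Y), Y')`: its density relative to `π ⊗ γ` depends on `(Y, Y')` alone, so its
  -- divergence is explicit although that of `(Z, Y')` is not.
  set Φ : (EuclideanSpace ℝ (Fin n) × EuclideanSpace ℝ (Fin n)) × EuclideanSpace ℝ (Fin n) →
    (EuclideanSpace ℝ (Fin n) × EuclideanSpace ℝ (Fin n)) × EuclideanSpace ℝ (Fin n) :=
    fun q => (q.1, ρ • q.1.2 + √(1 - ρ ^ 2) • q.2) with hΦ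
  have hΦm : Measurable Φ := by fun_prop
  have hPp : IsProbabilityMeasure ((π.prod γ).map Φ) :=
    Measure.isProbabilityMeasure_map hΦm.aemeasurable
  have hnc := h.noisyCoupling hρ
  have hdiag := isCoupling_map_snd_snd h
  have hdiagn := hdiag.noisyCoupling hρ
  have hmap1 : InfoOT.noisyCoupling ρ π =
      ((π.prod γ).map Φ).map (fun q => (q.1.1, q.2)) := by
    rw [Measure.map_map (by fun_prop) hΦm]
    rfl
  have hmap2 : μ.prod γ = (π.prod γ).map (fun q => (q.1.1, q.2)) := by
    have h1 : (fun q : (EuclideanSpace ℝ (Fin n) × EuclideanSpace ℝ (Fin n)) ×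
      EuclideanSpace ℝ (Fin n) => (q.1.1, q.2)) = Prod.map Prod.fst id := rfl
    rw [h1, ← Measure.map_prod_map _ _ measurable_fst measurable_id, Measure.map_id, ← h.1]
    rfl
  have hmap3 : InfoOT.noisyCoupling ρ (π.map fun p => (p.2, p.2)) =
      ((π.prod γ).map Φ).map (fun q => (q.1.2, q.2)) := by
    rw [Measure.map_map (by fun_prop) hΦm, InfoOT.noisyCoupling, ← hγ]
    have h1 : (π.map fun p => (p.2, p.2)).prod γ =
        (π.prod γ).map (Prod.map (fun p => (p.2, p.2)) id) := by
      rw [← Measure.map_prod_map _ _ (by fun_prop) measurable_id, Measure.map_id]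
    rw [h1, Measure.map_map (by fun_prop) (by fun_prop)]
    rfl
  obtain ⟨hint, hval⟩ := hdiagn.integral_logMehler ρ
  rw [hdiag.integral_inner_noisyCoupling memLp_two_stdGaussian,
    integral_map (by fun_prop) (by fun_prop)] at hval
  simp_rw [real_inner_self_eq_norm_sq] at hval
  rw [h.integral_norm_sq_snd memLp_two_stdGaussian, integral_norm_sq_stdGaussian] at hval
  rw [hmap3] at hint hval
  rw [integral_map (by fun_prop) (by fun_prop)] at hval
  have hwd : (π.prod γ).map Φ = (π.prod γ).withDensity
      fun q => ENNReal.ofReal (Real.exp (logMehler ρ (q.1.2, q.2))) :=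
    map_channel_eq_withDensity hρ
  have hint' : Integrable (fun q => logMehler ρ (q.1.2, q.2)) ((π.prod γ).map Φ) :=
    Integrable.comp_measurable (f := fun q : (EuclideanSpace ℝ (Fin n) × EuclideanSpace ℝ (Fin n)) ×
      EuclideanSpace ℝ (Fin n) => (q.1.2, q.2)) hint (by fun_prop)
  have hL : Measurable fun q : (EuclideanSpace ℝ (Fin n) × EuclideanSpace ℝ (Fin n)) ×
      EuclideanSpace ℝ (Fin n) => logMehler ρ (q.1.2, q.2) := by fun_prop
  have hkl : klDiv ((π.prod γ).map Φ) (π.prod γ) = _ := klDiv_withDensity_exp hL hwd hint'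
  -- Data processing under forgetting `Y`. Since `E⟪Y, Y'⟫ = nρ`, the quadratic part of the expected
  -- log-density vanishes.
  have hdpi := InformationTheory.klDiv_map_le ((π.prod γ).map Φ) (π.prod γ)
    (g := fun q => (q.1.1, q.2)) (by fun_prop)
  rw [← hmap1, ← hmap2, hkl, hval] at hdpi
  rw [mutualInfo, hnc.1, hnc.2]
  refine hdpi.trans ?_
  refine ENNReal.ofReal_le_ofReal (le_of_eq ?_)
  ring

lemma lintegral_exp_logMehler_prod (hρ : ρ ^ 2 < 1) :
    ∫⁻ p, ENNReal.ofReal (Real.exp (logMehler ρ p)) ∂(stdGaussian (EuclideanSpace ℝ (Fin n))).prod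
      (stdGaussian (EuclideanSpace ℝ (Fin n))) = 1 := by
  rw [lintegral_prod _ (by fun_prop)]
  simp [lintegral_exp_logMehler hρ]

lemma integral_inner_prod_stdGaussian (hmom : MemLp (fun x => x) 2 μ) :
    ∫ p, ⟪p.1, p.2⟫ ∂μ.prod (stdGaussian (EuclideanSpace ℝ (Fin n))) = 0 := by
  rw [integral_prod _ ((isCoupling_prod _ _).integrable_inner hmom memLp_two_stdGaussian)]
  simp [integral_inner_stdGaussian]

/-- Standard Gaussian vectors with mutual information at most `-(n / 2) log (1 - ρ²)` have
correlation at most `n ρ`. -/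
lemma IsCoupling.integral_inner_le_of_mutualInfo_le
    (h : IsCoupling π (stdGaussian _) (stdGaussian _)) (hρ0 : 0 ≤ ρ) (hρ : ρ ^ 2 < 1)
    (hI : mutualInfo π ≤ ENNReal.ofReal (-(n / 2) * Real.log (1 - ρ ^ 2))) :
    ∫ p, ⟪p.1, p.2⟫ ∂π ≤ n * ρ := by
  have := h.isProbabilityMeasure
  have hρ1 : 0 < 1 - ρ ^ 2 := by linarith
  rw [mutualInfo, h.1, h.2] at hI
  -- The argument ends by dividing by `ρ`; at `ρ = 0` the information is zero and the vectors are
  -- independent.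
  rcases hρ0.eq_or_lt with rfl | hρ0
  · have h0 : klDiv π ((stdGaussian _).prod (stdGaussian _)) = 0 := by simpa using hI
    rw [InformationTheory.klDiv_eq_zero_iff] at h0
    rw [h0, integral_inner_prod_stdGaussian memLp_two_stdGaussian]
    simp
  have hnn : 0 ≤ -((n : ℝ) / 2) * Real.log (1 - ρ ^ 2) := by
    have := Real.log_nonpos hρ1.le (by nlinarith)
    have hn : (0 : ℝ) ≤ n / 2 := by positivity
    nlinarith
  obtain ⟨hint, hval⟩ := h.integral_logMehler ρ
  -- The logarithmic term of the test function equals the allowed information, so only the sign of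
  -- the quadratic term remains.
  have hdv := integral_le_toReal_klDiv hint (by fun_prop) (lintegral_exp_logMehler_prod hρ)
    (ne_top_of_le_ne_top ENNReal.ofReal_ne_top hI)
  have hI' := ENNReal.toReal_mono ENNReal.ofReal_ne_top hI
  rw [ENNReal.toReal_ofReal hnn] at hI'
  rw [hval] at hdv
  have h2 : 0 ≤ (2 * n * ρ ^ 2 - 2 * ρ * ∫ p, ⟪p.1, p.2⟫ ∂π) / (2 * (1 - ρ ^ 2)) := by linarith
  rw [le_div_iff₀ (by positivity), zero_mul] at h2
  have h3 : 0 ≤ ρ * (n * ρ - ∫ p, ⟪p.1, p.2⟫ ∂π) := by nlinarith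
  linarith [nonneg_of_mul_nonneg_right h3 hρ0]

lemma memLp_two_scaledGaussian (m : EuclideanSpace ℝ (Fin n)) (σ : ℝ) :
    MemLp (fun x => x) 2 (scaledGaussian m σ) :=
  (memLp_map_measure_iff (by fun_prop) (by fun_prop)).2
    ((memLp_const m).add (memLp_two_stdGaussian.const_smul σ))

/-- Standardising the first vector does not increase information and divides the correlation by `σ`;
the mean `m` contributes nothing because the second vector is centred. -/
lemma IsCoupling.integral_inner_scaledGaussian_le {m : EuclideanSpace ℝ (Fin n)} {σ : ℝ}
    (hσ : 0 < σ) (h : IsCoupling π (scaledGaussian m σ) (stdGaussian _)) (hρ0 : 0 ≤ ρ)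
    (hρ : ρ ^ 2 < 1)
    (hI : mutualInfo π ≤ ENNReal.ofReal (-(n / 2) * Real.log (1 - ρ ^ 2))) :
    ∫ p, ⟪p.1, p.2⟫ ∂π ≤ n * (ρ * σ) := by
  have := h.isProbabilityMeasure
  have hσmap : (scaledGaussian m σ).map (fun x => σ⁻¹ • (x - m)) =
      stdGaussian (EuclideanSpace ℝ (Fin n)) := by
    rw [scaledGaussian, Measure.map_map (by fun_prop) (by fun_prop)]
    have h1 : (fun x => σ⁻¹ • (x - m)) ∘ (fun x => m + σ • x) = id := by
      ext1 x; simp [smul_smul, hσ.ne']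
    rw [h1, Measure.map_id]
  have hc : IsCoupling (π.map (Prod.map (fun x => σ⁻¹ • (x - m)) id))
      (stdGaussian (EuclideanSpace ℝ (Fin n))) (stdGaussian (EuclideanSpace ℝ (Fin n))) := by
    have := h.map (f := fun x => σ⁻¹ • (x - m)) (g := id) (by fun_prop) measurable_id
    rwa [hσmap, Measure.map_id] at this
  have hle : mutualInfo (π.map (Prod.map (fun x => σ⁻¹ • (x - m)) id)) ≤ mutualInfo π := by
    rw [mutualInfo, mutualInfo, hc.1, hc.2, h.1, h.2]
    have h1 : (stdGaussian (EuclideanSpace ℝ (Fin n))).prod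
        (stdGaussian (EuclideanSpace ℝ (Fin n))) =
        ((scaledGaussian m σ).prod (stdGaussian _)).map
          (Prod.map (fun x => σ⁻¹ • (x - m)) id) := by
      rw [← Measure.map_prod_map _ _ (by fun_prop) measurable_id, hσmap, Measure.map_id]
    rw [h1]
    exact InformationTheory.klDiv_map_le _ _ (by fun_prop)
  have key := hc.integral_inner_le_of_mutualInfo_le hρ0 hρ (hle.trans hI)
  have hm : ∫ p, ⟪m, p.2⟫ ∂π = 0 := by
    have h1 := integral_inner_stdGaussian m
    rw [← h.2, Measure.snd, integral_map (by fun_prop) (by fun_prop)] at h1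
    exact h1
  have hmi : Integrable (fun p : EuclideanSpace ℝ (Fin n) × EuclideanSpace ℝ (Fin n) =>
      ⟪m, p.2⟫) π :=
    integrable_inner_of_memLp (memLp_const m) (h.memLp_snd memLp_two_stdGaussian)
  rw [integral_map (by fun_prop) (by fun_prop)] at key
  simp only [Prod.map_fst, Prod.map_snd, id_eq, real_inner_smul_left, inner_sub_left] at key
  rw [integral_const_mul, integral_sub
    (h.integrable_inner (memLp_two_scaledGaussian m σ) memLp_two_stdGaussian) hmi, hm, sub_zero,
    inv_mul_le_iff₀ hσ] at key
  linarith

end Channel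

open scoped MatrixOrder

/-! ### From couplings to the constrained Wasserstein distance. -/

section InfoWasserstein

variable {n : ℕ}

lemma IsCoupling.lintegral_edist_rpow_two
    {P : Measure (EuclideanSpace ℝ (Fin n) × EuclideanSpace ℝ (Fin n))}
    {μ ν : Measure (EuclideanSpace ℝ (Fin n))} (h : IsCoupling P μ ν)
    (hμ : MemLp (fun x => x) 2 μ) (hν : MemLp (fun x => x) 2 ν) :
    (∫⁻ ω, edist ω.1 ω.2 ^ (2 : ℝ) ∂P) ^ (1 / (2 : ℝ)) =
      ENNReal.ofReal √(∫ p, ‖p.1 - p.2‖ ^ 2 ∂P) := by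
  have h1 : ∀ ω : EuclideanSpace ℝ (Fin n) × EuclideanSpace ℝ (Fin n),
      edist ω.1 ω.2 ^ (2 : ℝ) = ENNReal.ofReal (‖ω.1 - ω.2‖ ^ 2) := fun ω => by
    rw [edist_dist, dist_eq_norm, ENNReal.ofReal_pow (norm_nonneg _), ENNReal.rpow_ofNat]
  simp_rw [h1]
  rw [← ofReal_integral_eq_lintegral_ofReal (h.integrable_norm_sub_sq hμ hν)
    (ae_of_all _ fun _ => sq_nonneg _), Real.sqrt_eq_rpow,
    ENNReal.ofReal_rpow_of_nonneg (integral_nonneg fun _ => sq_nonneg _) (by norm_num)]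

section Bounds

variable {μ ν : Measure (EuclideanSpace ℝ (Fin n))} {R : ℝ≥0∞} {b : ℝ}

lemma infoWasserstein_two_sq_le
    {P : Measure (EuclideanSpace ℝ (Fin n) × EuclideanSpace ℝ (Fin n))} (h : IsCoupling P μ ν)
    (hμ : MemLp (fun x => x) 2 μ) (hν : MemLp (fun x => x) 2 ν) (hI : mutualInfo P ≤ R)
    (hb : ∫ p, ‖p.1 - p.2‖ ^ 2 ∂P ≤ b) :
    infoWasserstein 2 μ ν R < ∞ ∧ (infoWasserstein 2 μ ν R).toReal ^ 2 ≤ b := by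
  have hle : infoWasserstein 2 μ ν R ≤ ENNReal.ofReal √(∫ p, ‖p.1 - p.2‖ ^ 2 ∂P) := by
    rw [← h.lintegral_edist_rpow_two hμ hν]
    exact iInf₂_le P ⟨h, hI⟩
  refine ⟨hle.trans_lt ENNReal.ofReal_lt_top, ?_⟩
  have h2 := ENNReal.toReal_mono ENNReal.ofReal_ne_top hle
  rw [ENNReal.toReal_ofReal (Real.sqrt_nonneg _)] at h2
  have h3 := pow_le_pow_left₀ ENNReal.toReal_nonneg h2 2
  rw [Real.sq_sqrt (integral_nonneg fun _ => sq_nonneg _)] at h3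
  exact h3.trans hb

lemma le_infoWasserstein_two_sq (hμ : MemLp (fun x => x) 2 μ) (hν : MemLp (fun x => x) 2 ν)
    (hfin : infoWasserstein 2 μ ν R < ∞) (hb0 : 0 ≤ b)
    (hb : ∀ P, IsCoupling P μ ν → mutualInfo P ≤ R → b ≤ ∫ p, ‖p.1 - p.2‖ ^ 2 ∂P) :
    b ≤ (infoWasserstein 2 μ ν R).toReal ^ 2 := by
  have hle : ENNReal.ofReal √b ≤ infoWasserstein 2 μ ν R := by
    refine le_iInf₂ fun P hP => ?_
    rw [hP.1.lintegral_edist_rpow_two hμ hν]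
    exact ENNReal.ofReal_le_ofReal (Real.sqrt_le_sqrt (hb P hP.1 hP.2))
  have h2 := ENNReal.toReal_mono hfin.ne hle
  rw [ENNReal.toReal_ofReal (Real.sqrt_nonneg _)] at h2
  have h3 := pow_le_pow_left₀ (Real.sqrt_nonneg _) h2 2
  rwa [Real.sq_sqrt hb0] at h3

end Bounds

lemma infoBound_of_entropy_eq_bot (hn : 1 ≤ n) {μ : Measure (EuclideanSpace ℝ (Fin n))}
    (h : differentialEntropy μ = ⊥) (R : ℝ) : infoBound n μ R = ∫ z, ‖z‖ ^ 2 ∂μ + n := by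
  have hn0 : (0 : ℝ) < n := by exact_mod_cast hn
  rw [infoBound, h, EReal.coe_mul_bot_of_pos (by positivity), EReal.exp_bot]
  simp

lemma infoBound_of_entropy_eq_coe (hn : 1 ≤ n) {μ : Measure (EuclideanSpace ℝ (Fin n))} {H : ℝ}
    (h : differentialEntropy μ = (H : EReal)) (R : ℝ) :
    infoBound n μ R = ∫ z, ‖z‖ ^ 2 ∂μ + n - 2 * (√(1 - Real.exp (-(2 * R / n))) *
      (n * Real.exp (H / n - 1 / 2 - Real.log (2 * Real.pi) / 2))) := by
  have hn0 : (0 : ℝ) < n := by exact_mod_cast hn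
  rw [infoBound, h, ← EReal.coe_mul, EReal.exp_coe, ENNReal.toReal_ofReal (Real.exp_pos _).le]
  have h1 : 1 / (2 * Real.pi * Real.exp 1) * Real.exp (2 / n * H) =
      Real.exp (H / n - 1 / 2 - Real.log (2 * Real.pi) / 2) ^ 2 := by
    rw [← Real.exp_nat_mul]
    have h2 : (2 : ℕ) * (H / n - 1 / 2 - Real.log (2 * Real.pi) / 2) =
        2 / n * H - Real.log (2 * Real.pi) - 1 := by push_cast; ring
    rw [h2, Real.exp_sub, Real.exp_sub, Real.exp_log (by positivity)]
    field_simp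
  rw [h1, Real.sqrt_mul (sq_nonneg _), Real.sqrt_sq (Real.exp_pos _).le]
  ring

lemma sq_sqrt_one_sub_exp {R : ℝ} (hR : 0 ≤ R) (n : ℕ) :
    √(1 - Real.exp (-(2 * R / n))) ^ 2 = 1 - Real.exp (-(2 * R / n)) :=
  Real.sq_sqrt (sub_nonneg.2 (Real.exp_le_one_iff.2 (neg_nonpos.2 (by positivity))))

lemma sq_sqrt_one_sub_exp_lt_one {R : ℝ} (hR : 0 ≤ R) (n : ℕ) :
    √(1 - Real.exp (-(2 * R / n))) ^ 2 < 1 := by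
  rw [sq_sqrt_one_sub_exp hR]
  linarith [Real.exp_pos (-(2 * R / n))]

/-- This identity dictates the choice of `ρ`: the channel's information is then exactly the budget
`R`, in both the upper bound and the converse. -/
lemma neg_mul_log_one_sub_sq (hn : 1 ≤ n) {R : ℝ} (hR : 0 ≤ R) :
    -((n : ℝ) / 2) * Real.log (1 - √(1 - Real.exp (-(2 * R / n))) ^ 2) = R := by
  have hn0 : (0 : ℝ) < n := by exact_mod_cast hn
  rw [sq_sqrt_one_sub_exp hR, sub_sub_cancel, Real.log_exp]
  field_simp

/-- With entropy `-∞` the bound is the cost of the independent coupling; otherwise the Talagrand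
coupling is passed through the channel. -/
lemma exists_coupling_le_infoBound (hn : 1 ≤ n) (μ : Measure (EuclideanSpace ℝ (Fin n)))
    [IsProbabilityMeasure μ] (hac : μ ≪ volume) (hmom : MemLp (fun x => x) 2 μ) {R : ℝ}
    (hR : 0 ≤ R) :
    ∃ P, IsCoupling P μ (stdGaussian (EuclideanSpace ℝ (Fin n))) ∧
      mutualInfo P ≤ ENNReal.ofReal R ∧ ∫ p, ‖p.1 - p.2‖ ^ 2 ∂P ≤ infoBound n μ R := by
  rcases differentialEntropy_eq_bot_or hac hmom with hbot | hint
  · have hc := isCoupling_prod μ (stdGaussian (EuclideanSpace ℝ (Fin n)))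
    refine ⟨_, hc, ?_, ?_⟩
    · rw [mutualInfo, hc.1, hc.2, InformationTheory.klDiv_self]
      exact zero_le
    · rw [hc.integral_norm_sub_sq hmom memLp_two_stdGaussian,
        integral_inner_prod_stdGaussian hmom, integral_norm_sq_stdGaussian,
        infoBound_of_entropy_eq_bot hn hbot]
      simp
  · obtain ⟨π, hπ, hle⟩ := exists_coupling_le_integral_inner hn hac hint hmom
    have hρ := sq_sqrt_one_sub_exp_lt_one hR n
    refine ⟨_, hπ.noisyCoupling hρ, ?_, ?_⟩
    · have := hπ.mutualInfo_noisyCoupling_le hρ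
      rwa [neg_mul_log_one_sub_sq hn hR] at this
    · rw [(hπ.noisyCoupling hρ).integral_norm_sub_sq hmom memLp_two_stdGaussian,
        hπ.integral_inner_noisyCoupling hmom, integral_norm_sq_stdGaussian,
        infoBound_of_entropy_eq_coe hn (differentialEntropy_of_integrable_llr hac hint)]
      have := mul_le_mul_of_nonneg_left hle (Real.sqrt_nonneg (1 - Real.exp (-(2 * R / n))))
      linarith

lemma differentialEntropy_scaledGaussian (m : EuclideanSpace ℝ (Fin n)) {σ : ℝ} (hσ : 0 < σ) :
    differentialEntropy (scaledGaussian m σ) =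
      ((n / 2 * Real.log (2 * Real.pi * σ ^ 2) + n / 2 : ℝ) : EReal) := by
  have heq := scaledGaussian_eq_withDensity m hσ
  have hac : scaledGaussian m σ ≪ volume := heq ▸ withDensity_absolutelyContinuous _ _
  have hllr : llr (scaledGaussian m σ) volume =ᵐ[scaledGaussian m σ] logGaussian m σ := by
    refine hac.ae_le ?_
    rw [heq]
    filter_upwards [Measure.rnDeriv_withDensity volume
      (f := fun x => ENNReal.ofReal (Real.exp (logGaussian m σ x))) (by fun_prop)] with x hx
    rw [llr, hx, ENNReal.toReal_ofReal (Real.exp_pos _).le, Real.log_exp]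
  have hint := integrable_logGaussian (memLp_two_scaledGaussian m σ) m σ
  rw [differentialEntropy_of_integrable_llr hac ((integrable_congr hllr).2 hint),
    integral_congr_ae hllr, scaledGaussian, integral_map (by fun_prop) (by fun_prop)]
  have h1 : ∀ x : EuclideanSpace ℝ (Fin n), logGaussian m σ (m + σ • x) =
      -(n / 2) * Real.log (2 * Real.pi * σ ^ 2) - ‖x‖ ^ 2 / 2 := fun x => by
    rw [logGaussian, add_sub_cancel_left, norm_smul, mul_pow, Real.norm_eq_abs, sq_abs]
    field_simp
  simp_rw [h1]
  rw [integral_sub (integrable_const _)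
    ((memLp_two_stdGaussian.integrable_norm_pow two_ne_zero).div_const 2), integral_div,
    integral_norm_sq_stdGaussian]
  congr 1
  simp only [integral_const, probReal_univ, one_smul]
  ring

/-- The positive square root of `σ² I` is `σ I`, which needs `σ I` to be positive. -/
lemma multivariateGaussian_smul_one (m : EuclideanSpace ℝ (Fin n)) {σ : ℝ} (hσ : 0 < σ) :
    multivariateGaussian m (σ ^ 2 • (1 : Matrix (Fin n) (Fin n) ℝ)) = scaledGaussian m σ := by
  have hpos : (0 : Matrix (Fin n) (Fin n) ℝ) ≤ σ • 1 :=
    smul_nonneg hσ.le zero_le_one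
  have hsq : CFC.sqrt (σ ^ 2 • (1 : Matrix (Fin n) (Fin n) ℝ)) = σ • 1 := by
    have := CFC.sqrt_mul_self (σ • (1 : Matrix (Fin n) (Fin n) ℝ)) hpos
    rwa [smul_mul_smul_comm, one_mul, ← sq] at this
  rw [multivariateGaussian, scaledGaussian, hsq]
  congr 1
  ext1 x
  simp

lemma infoBound_scaledGaussian (hn : 1 ≤ n) (m : EuclideanSpace ℝ (Fin n)) {σ : ℝ} (hσ : 0 < σ)
    (R : ℝ) :
    infoBound n (scaledGaussian m σ) R = ∫ z, ‖z‖ ^ 2 ∂scaledGaussian m σ + n -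
      2 * (n * (√(1 - Real.exp (-(2 * R / n))) * σ)) := by
  have hn0 : (0 : ℝ) < n := by exact_mod_cast hn
  have h1 : Real.exp ((n / 2 * Real.log (2 * Real.pi * σ ^ 2) + n / 2) / n - 1 / 2 -
      Real.log (2 * Real.pi) / 2) = σ := by
    rw [Real.log_mul (by positivity) (by positivity), Real.log_pow]
    have h2 : (n / 2 * (Real.log (2 * Real.pi) + (2 : ℕ) * Real.log σ) + n / 2) / n - 1 / 2 -
        Real.log (2 * Real.pi) / 2 = Real.log σ := by
      push_cast; field_simp; ring
    rw [h2, Real.exp_log hσ]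
  rw [infoBound_of_entropy_eq_coe hn (differentialEntropy_scaledGaussian m hσ), h1]
  ring

end InfoWasserstein

end InfoOT

/-! ### The theorem. -/

theorem theoremT (n : ℕ) (hn : 1 ≤ n)
    (PZ : MeasureTheory.Measure (EuclideanSpace ℝ (Fin n)))
    [MeasureTheory.IsProbabilityMeasure PZ]
    (hPZ : PZ.AbsolutelyContinuous (ProbabilityTheory.stdGaussian (EuclideanSpace ℝ (Fin n))))
    (hmom : MeasureTheory.MemLp (fun z : EuclideanSpace ℝ (Fin n) => z) 2 PZ)
    (R : ℝ) (hR : 0 ≤ R) :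
    InfoOT.differentialEntropy PZ < ⊤ ∧
    InfoOT.infoWasserstein 2 PZ (ProbabilityTheory.stdGaussian (EuclideanSpace ℝ (Fin n)))
      (ENNReal.ofReal R) < ⊤ ∧
    (InfoOT.infoWasserstein 2 PZ (ProbabilityTheory.stdGaussian (EuclideanSpace ℝ (Fin n)))
      (ENNReal.ofReal R)).toReal ^ 2 ≤ InfoOT.infoBound n PZ R ∧
    (∀ (m : EuclideanSpace ℝ (Fin n)) (σ : ℝ), 0 < σ →
      PZ = ProbabilityTheory.multivariateGaussian m
        (σ ^ 2 • (1 : Matrix (Fin n) (Fin n) ℝ)) →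
      (InfoOT.infoWasserstein 2 PZ (ProbabilityTheory.stdGaussian (EuclideanSpace ℝ (Fin n)))
        (ENNReal.ofReal R)).toReal ^ 2 = InfoOT.infoBound n PZ R) := by
  have hac := hPZ.trans InfoOT.stdGaussian_absolutelyContinuous_volume
  obtain ⟨P, hP, hI, hle⟩ := InfoOT.exists_coupling_le_infoBound hn PZ hac hmom hR
  obtain ⟨hfin, hbound⟩ :=
    InfoOT.infoWasserstein_two_sq_le hP hmom InfoOT.memLp_two_stdGaussian hI hle
  refine ⟨?_, hfin, hbound, ?_⟩
  · rcases InfoOT.differentialEntropy_eq_bot_or hac hmom with h | h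
    · rw [h]; exact bot_lt_top
    · rw [InfoOT.differentialEntropy_of_integrable_llr hac h]; exact EReal.coe_lt_top _
  · intro m σ hσ hPZeq
    -- The bound is nonnegative because it dominates a square, so it suffices to bound the cost of
    -- each admissible coupling from below.
    refine le_antisymm hbound (InfoOT.le_infoWasserstein_two_sq hmom
      InfoOT.memLp_two_stdGaussian hfin ((sq_nonneg _).trans hbound) fun Q hQ hQI => ?_)
    rw [InfoOT.multivariateGaussian_smul_one m hσ] at hPZeq
    subst hPZeq
    rw [← InfoOT.neg_mul_log_one_sub_sq hn hR] at hQI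
    have key := hQ.integral_inner_scaledGaussian_le hσ (Real.sqrt_nonneg _)
      (InfoOT.sq_sqrt_one_sub_exp_lt_one hR n) hQI
    rw [InfoOT.infoBound_scaledGaussian hn m hσ, hQ.integral_norm_sub_sq hmom
      InfoOT.memLp_two_stdGaussian, InfoOT.integral_norm_sq_stdGaussian]
    linarith
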